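/- Let $J\in\mathbb R^{3\times 3}$ be symmetric positive definite. For gains $K_p,K_d>0$ consider the closed-loop attitude error dynamics $$\dot{\tilde q}=\tfrac12 E(\tilde q)(\omega_d-\omega),\qquad J\dot\omega=-\omega\times J\omega+\tau,\qquad \tau=K_p\tilde q_v-K_d\,\omega ,$$ where $\tilde q=(\tilde q_0,\tilde q_v)\in\mathbb R\times\mathbb R^3$ is a unit quaternion, $\omega\in\mathbb R^3$, and $E(\tilde q)v=\big(-\tilde q_v^{T}v,\ \tilde q_0v-\tilde q_v\times v\big)$. The input is the desired angular velocity $\omega_d$, measurable and essentially bounded on $[0,\infty)$. The solutions are the Carathéodory solutions on $[0,\infty)$ with $|\tilde q(0)|=1$. Let $\tilde\zeta=2\arccos\tilde q_0\in[0,2\pi]$ be the attitude error angle, and let $|(\tilde q,\omega)|:=\sqrt{\tilde\zeta^2+|\omega|^2}$ be the size of the state measured from the equilibrium $\tilde q=(1,0)$, $\omega=0$. Fix $c>0$ and $\tilde\zeta_{\max}\in(0,2\pi)$, and let $K_d=c\sqrt{K_p}$. Then: 1. (ISS.) For every $K_p>0$, there is a solution on $[0,\infty)$ for every initial state with $|\tilde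 q(0)|=1$ and every input, and the system is input-to-state stable with respect to $\omega_d$ with the restriction $\tilde\zeta\le\tilde\zeta_{\max}$. That is, there are $\beta\in\mathcal{KL}$ and $\gamma\in\mathcal K$ such that, for every input and solution and every $T\ge0$ with $\tilde\zeta(t)\le\tilde\zeta_{\max}$ on $[0,T]$, $$|(\tilde q(T),\omega(T))|\le\beta\big(|(\tilde q(0),\omega(0))|,T\big)+\gamma\big(\|\omega_d\|_{L^\infty(0,T)}\big).$$ 2. (Asymptotic gain.) Call $\gamma_{in}\in\mathcal K$ an asymptotic gain from $\omega_d$ to $\tilde\zeta$ if $\limsup_{t\to\infty}\tilde\zeta(t)\le\gamma_{in}\big(\operatorname{ess\,limsup}_{t\to\infty}|\omega_d(t)|\big)$ for all inputs and all solutions with $\tilde\zeta(t)\le\tilde\zeta_{\max}$ for all $t\ge0$. The asymptotic gain can be made arbitrarily small: for every $\varepsilon>0$ there is $K_0>0$ such that $s\mapsto\varepsilon s$ is an asymptotic gain for all $K_p\ge K_0$. More precisely, it scales like $1/\sqrt{K_p}$: there are $C,\delta>0$, independent of $K_p$, such that for all $K_p>0$ the function $s\mapsto Cs/\sqrt{K_p}$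 is an asymptotic gain, and every asymptotic gain $\gamma_{in}$ satisfies $\gamma_{in}(s)\ge 2cs/\sqrt{K_p}$ for $0\le s\le\delta\sqrt{K_p}$. 3. (The restriction holds on explicit sets.) For every $\tilde\zeta_0<\tilde\zeta_{\max}$ there is $r>0$, independent of $K_p$, such that for all $K_p>0$ every solution with $\tilde\zeta(0)\le\tilde\zeta_0$, $|\omega(0)|\le r\sqrt{K_p}$ and $\|\omega_d\|_{L^\infty(0,\infty)}\le r\sqrt{K_p}$ satisfies $\tilde\zeta(t)<\tilde\zeta_{\max}$ for all $t\ge0$. -/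

import Mathlib

open Set Filter Topology MeasureTheory

open scoped Matrix

noncomputable section

namespace AttitudeLoop

/-- The space `ℝ³` with the Euclidean norm. -/
abbrev E3 := EuclideanSpace ℝ (Fin 3)

/-- Quaternions `(q₀, q_v)`, stored as vectors of `ℝ⁴` with the Euclidean norm; the entry `0` is
the real part `q₀` and the entries `1, 2, 3` are the imaginary part `q_v`. -/
abbrev Quat := EuclideanSpace ℝ (Fin 4)

/-- The imaginary part `q_v ∈ ℝ³` of a quaternion. -/
def imPart (q : Quat) : E3 := !₂[q 1, q 2, q 3]

/-- The skew operator `ω ↦ ω^∧`, so that `ω^∧ x = ω × x`. -/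
def skew (w : E3) : Matrix (Fin 3) (Fin 3) ℝ :=
  !![0, -w 2, w 1;
     w 2, 0, -w 0;
     -w 1, w 0, 0]

/-- The `4 × 3` matrix `E(q) = [-q_v, q₀ I₃ + q_v^∧]ᵀ` of the quaternion differential kinematics.
-/
def kinMatrix (q : Quat) : Matrix (Fin 4) (Fin 3) ℝ :=
  !![-q 1, q 0, -q 3, q 2;
     -q 2, q 3, q 0, -q 1;
     -q 3, -q 2, q 1, q 0]ᵀ

/-- The PD torque `τ = K_p q̃_v - K_d ω`. -/
def torque (Kp Kd : ℝ) (q : Quat) (w : E3) : E3 := Kp • imPart q - Kd • w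

/-- `(q, w)` is a (Carathéodory) solution on `[0, ∞)` of the closed-loop attitude error dynamics
`q' = ½ E(q) (ω_d - w)`, `J w' = - w^∧ J w + τ`, with inertia matrix `J`, gains `Kp`, `Kd` and
input `u = ω_d`, starting at a unit quaternion: both components are absolutely continuous on
compact intervals and satisfy the differential equations at almost every time. -/
structure IsSolution (J : Matrix (Fin 3) (Fin 3) ℝ) (Kp Kd : ℝ) (u : ℝ → E3)
    (q : ℝ → Quat) (w : ℝ → E3) : Prop where
  unit_init : ‖q 0‖ = 1
  absCont_q : ∀ T : ℝ, 0 ≤ T → AbsolutelyContinuousOnInterval q 0 T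
  absCont_w : ∀ T : ℝ, 0 ≤ T → AbsolutelyContinuousOnInterval w 0 T
  kinematics : ∀ᵐ t ∂(volume.restrict (Ici (0 : ℝ))),
    HasDerivAt q (WithLp.toLp 2 ((1 / 2 : ℝ) • (kinMatrix (q t) *ᵥ (u t - w t).ofLp))) t
  euler : ∀ᵐ t ∂(volume.restrict (Ici (0 : ℝ))), ∃ w' : E3, HasDerivAt w w' t ∧
    J *ᵥ w'.ofLp =
      -(skew (w t) *ᵥ (J *ᵥ (w t).ofLp)) + (torque Kp Kd (q t) (w t)).ofLp

/-- Admissible inputs: measurable and essentially bounded on `[0, ∞)`. -/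
def IsInput (u : ℝ → E3) : Prop := MemLp u ⊤ (volume.restrict (Ici (0 : ℝ)))

/-- The norm of `u` in `L^∞(0, T)`. -/
def supNorm (u : ℝ → E3) (T : ℝ) : ℝ :=
  (eLpNorm u ⊤ (volume.restrict (Icc (0 : ℝ) T))).toReal

/-- The asymptotic norm of an essentially bounded `u`: the essential limit superior of `‖u t‖`
as `t → ∞`. -/
def asympNorm (u : ℝ → E3) : ℝ := limsup (fun t => ‖u t‖) (atTop ⊓ ae volume)

/-- The error angle `ζ̃ ∈ [0, 2π]` of a unit quaternion: `q₀ = cos (ζ̃ / 2)` and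
`‖q_v‖ = sin (ζ̃ / 2)`. -/
def errAngle (q : Quat) : ℝ := 2 * Real.arccos (q 0)

/-- The size of the state `(q, w)`, measured from the equilibrium `q = (1, 0)`, `w = 0`. -/
def stateNorm (q : Quat) (w : E3) : ℝ := Real.sqrt (errAngle q ^ 2 + ‖w‖ ^ 2)

/-- Class `𝒦`: continuous and strictly increasing on `[0, ∞)`, zero at zero. -/
def IsClassK (g : ℝ → ℝ) : Prop :=
  ContinuousOn g (Ici 0) ∧ StrictMonoOn g (Ici 0) ∧ g 0 = 0

/-- Class `𝒦ℒ`: class `𝒦` in the first argument, nonincreasing to zero in the second. -/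
def IsClassKL (b : ℝ → ℝ → ℝ) : Prop :=
  (∀ t : ℝ, 0 ≤ t → IsClassK fun s => b s t) ∧
  ∀ s : ℝ, 0 ≤ s → AntitoneOn (b s) (Ici 0) ∧ Tendsto (b s) atTop (𝓝 0)

/-- Forward completeness: for each initial state with a unit quaternion and each admissible input
there is a solution on `[0, ∞)`. -/
def IsForwardComplete (J : Matrix (Fin 3) (Fin 3) ℝ) (Kp Kd : ℝ) : Prop :=
  ∀ (q₀ : Quat) (w₀ : E3) (u : ℝ → E3), ‖q₀‖ = 1 → IsInput u →
    ∃ (q : ℝ → Quat) (w : ℝ → E3), IsSolution J Kp Kd u q w ∧ q 0 = q₀ ∧ w 0 = w₀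

/-- Input-to-state stability with respect to `ω_d`, with the restriction `ζ̃ ≤ zmax`: the
estimate holds along each solution for as long as the error angle has not exceeded `zmax`. -/
def IsISSWithin (J : Matrix (Fin 3) (Fin 3) ℝ) (Kp Kd zmax : ℝ) : Prop :=
  ∃ (b : ℝ → ℝ → ℝ) (g : ℝ → ℝ), IsClassKL b ∧ IsClassK g ∧
    ∀ (u : ℝ → E3) (q : ℝ → Quat) (w : ℝ → E3), IsInput u → IsSolution J Kp Kd u q w →
      ∀ T : ℝ, 0 ≤ T → (∀ t ∈ Icc (0 : ℝ) T, errAngle (q t) ≤ zmax) →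
        stateNorm (q T) (w T) ≤ b (stateNorm (q 0) (w 0)) T + g (supNorm u T)

/-- `g` is an asymptotic gain from `ω_d` to the error angle `ζ̃`, with the restriction
`ζ̃ ≤ zmax`. -/
def IsAsymptoticGainWithin (J : Matrix (Fin 3) (Fin 3) ℝ) (Kp Kd zmax : ℝ) (g : ℝ → ℝ) : Prop :=
  IsClassK g ∧
    ∀ (u : ℝ → E3) (q : ℝ → Quat) (w : ℝ → E3), IsInput u → IsSolution J Kp Kd u q w →
      (∀ t : ℝ, 0 ≤ t → errAngle (q t) ≤ zmax) →
        limsup (fun t => errAngle (q t)) atTop ≤ g (asympNorm u)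

end AttitudeLoop

end

/-! Write `k = √K_p`. Along solutions the energy `½⟪w, J w⟫ + 2k²(1 - q₀)` has derivative `-c k ‖w‖²
+ k²⟪q_v, ω_d⟫`: the gyroscopic torque does no work and the proportional terms cancel. This does not
damp the attitude, so `lyap` adds a small cross term `-l k ⟪q_v, J w⟫`, which contributes `-l
k³‖q_v‖²`. Since `‖q_v‖² = (1 - q₀)(1 + q₀)` and the angle restriction keeps `1 + q₀` away from
zero, the result is `V' ≤ -kαV + kG‖ω_d‖²` with `α`, `G` independent of `k` (`lyap_deriv_le`,
`exists_lyapunov`).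

Grönwall turns this into ISS. The forced part `(G/α)‖ω_d‖²` of `V` is free of `k` while `V ≥ k²(1 -
q₀)`, so the angle gain is `O(1/k)`. If rates and inputs are at most `r k`, every term at the first
time of reaching `zmax` scales like `k²`, and a small `r` excludes such a time. The lower bound on
the gain comes from equilibria: spinning at constant rate `s` about a principal axis requires `‖q_v‖
= cs/k`, an error angle of `2 arcsin(cs/k)`.

For existence, the field is multiplied by a bump function and solved by a weighted Picard iteration.
The bounds on `‖q‖` and on the kinetic energy are insensitive to the scalar factor, so the solution
stays where the bump equals `1`. -/

namespace AbsolutelyContinuousOnInterval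

/-! ### Absolutely continuous functions: composition and comparison -/

theorem comp_contDiff {E F : Type*} [NormedAddCommGroup E] [NormedSpace ℝ E] [ProperSpace E]
    [NormedAddCommGroup F] [NormedSpace ℝ F] {f : ℝ → E} {g : E → F} {a b : ℝ}
    (hf : AbsolutelyContinuousOnInterval f a b) (hg : ContDiff ℝ 1 g) :
    AbsolutelyContinuousOnInterval (fun t => g (f t)) a b := by
  -- The path stays in a closed ball, compact and convex, on which a `C¹` map is Lipschitz.
  obtain ⟨C, hC⟩ := hf.exists_bound
  obtain ⟨K, hK⟩ := hg.contDiffOn.exists_lipschitzOnWith (s := Metric.closedBall (0 : E) C)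
    (by decide) (convex_closedBall _ _) (isCompact_closedBall _ _)
  rw [absolutelyContinuousOnInterval_iff] at hf ⊢
  intro ε hε
  obtain ⟨δ, hδ, h⟩ := hf (ε / (K + 1)) (by positivity)
  refine ⟨δ, hδ, fun I hI hIδ => ?_⟩
  have hmem : ∀ t ∈ uIcc a b, f t ∈ Metric.closedBall (0 : E) C := fun t ht => by
    simpa using hC t ht
  calc ∑ i ∈ Finset.range I.1, dist (g (f (I.2 i).1)) (g (f (I.2 i).2))
      ≤ ∑ i ∈ Finset.range I.1, (K + 1 : ℝ) * dist (f (I.2 i).1) (f (I.2 i).2) := by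
        refine Finset.sum_le_sum fun i hi => ?_
        refine (hK.dist_le_mul _ (hmem _ (hI.1 i hi).1) _ (hmem _ (hI.1 i hi).2)).trans ?_
        gcongr
        simp
    _ = (K + 1 : ℝ) * ∑ i ∈ Finset.range I.1, dist (f (I.2 i).1) (f (I.2 i).2) :=
        (Finset.mul_sum ..).symm
    _ < (K + 1 : ℝ) * (ε / (K + 1)) := by
        gcongr
        exact h I hI hIδ
    _ = ε := by field_simp

theorem prodMk {X Y : Type*} [PseudoMetricSpace X] [PseudoMetricSpace Y] {f : ℝ → X} {g : ℝ → Y}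
    {a b : ℝ} (hf : AbsolutelyContinuousOnInterval f a b)
    (hg : AbsolutelyContinuousOnInterval g a b) :
    AbsolutelyContinuousOnInterval (fun t => (f t, g t)) a b := by
  rw [absolutelyContinuousOnInterval_iff] at hf hg ⊢
  intro ε hε
  obtain ⟨δ, hδ, h⟩ := hf (ε / 2) (by positivity)
  obtain ⟨δ', hδ', h'⟩ := hg (ε / 2) (by positivity)
  refine ⟨min δ δ', by positivity, fun I hI hIδ => ?_⟩
  have h1 := h I hI (hIδ.trans_le (min_le_left _ _))
  have h2 := h' I hI (hIδ.trans_le (min_le_right _ _))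
  refine lt_of_le_of_lt ?_ ((add_lt_add h1 h2).trans_eq (add_halves ε))
  rw [← Finset.sum_add_distrib]
  refine Finset.sum_le_sum fun i _ => ?_
  rw [Prod.dist_eq]
  exact max_le_add_of_nonneg dist_nonneg dist_nonneg

/-- Fundamental theorem of calculus for absolutely continuous functions. The derivative is an
existential witness, so that callers can supply whatever expression their derivative rules produce.
-/
theorem le_of_ae_deriv_nonpos {φ : ℝ → ℝ} {a b : ℝ} (hab : a ≤ b)
    (hφ : AbsolutelyContinuousOnInterval φ a b)
    (hd : ∀ᵐ t, t ∈ Ioc a b → ∃ d ≤ 0, HasDerivAt φ d t) : φ b ≤ φ a := by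
  have h := hφ.integral_deriv_eq_sub
  have h' : ∫ t in a..b, deriv φ t ≤ 0 := by
    rw [intervalIntegral.integral_of_le hab]
    refine integral_nonpos_of_ae ?_
    rw [EventuallyLE, ae_restrict_iff' measurableSet_Ioc]
    filter_upwards [hd] with t ht hmem
    obtain ⟨d, hd0, hd1⟩ := ht hmem
    simpa [hd1.deriv] using hd0
  linarith

/-- A barrier principle: a function that decreases wherever it exceeds a level `m` stays
below `m`. -/
theorem le_of_ae_deriv_nonpos_above {φ : ℝ → ℝ} {a b m : ℝ} (hab : a ≤ b)
    (hφ : AbsolutelyContinuousOnInterval φ a b) (ha : φ a ≤ m)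
    (hd : ∀ᵐ t, t ∈ Ioc a b → m < φ t → ∃ d ≤ 0, HasDerivAt φ d t) : φ b ≤ m := by
  have hcont : ContinuousOn φ (Icc a b) := by
    simpa [uIcc_of_le hab] using hφ.continuousOn
  -- After `sSup S`, the last time at or below level `m`, the function exceeds `m` and hence cannot
  -- increase.
  let S := Icc a b ∩ φ ⁻¹' Iic m
  have hS : IsClosed S := hcont.preimage_isClosed_of_isClosed isClosed_Icc isClosed_Iic
  have hne : S.Nonempty := ⟨a, ⟨le_rfl, hab⟩, ha⟩
  have hbdd : BddAbove S := ⟨b, fun t ht => ht.1.2⟩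
  have hs : sSup S ∈ S := hS.csSup_mem hne hbdd
  refine le_trans (le_of_ae_deriv_nonpos hs.1.2 (hφ.mono ?_) ?_) hs.2
  · rw [uIcc_of_le hs.1.2, uIcc_of_le hab]
    exact Icc_subset_Icc_left hs.1.1
  · filter_upwards [hd] with t ht hmem
    have htab : t ∈ Ioc a b := ⟨hs.1.1.trans_lt hmem.1, hmem.2⟩
    refine ht htab (not_le.1 fun hle => ?_)
    exact absurd (le_csSup hbdd ⟨Ioc_subset_Icc_self htab, hle⟩) (not_le.2 hmem.1)

/-- A differential form of Grönwall's inequality for dissipation estimates. -/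
theorem le_exp_mul_add_of_ae_deriv_le {φ : ℝ → ℝ} {a b α B : ℝ} (hab : a ≤ b) (hα : 0 < α)
    (hB : 0 ≤ B) (hφ : AbsolutelyContinuousOnInterval φ a b)
    (hd : ∀ᵐ t, t ∈ Ioc a b → ∃ d ≤ -α * φ t + B, HasDerivAt φ d t) :
    φ b ≤ Real.exp (-α * (b - a)) * φ a + B / α := by
  have hE : AbsolutelyContinuousOnInterval (fun t => Real.exp (α * (t - a))) a b :=
    ContDiffOn.absolutelyContinuousOnInterval (by fun_prop)
  have hc : AbsolutelyContinuousOnInterval (fun _ : ℝ => B / α) a b :=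
    ContDiffOn.absolutelyContinuousOnInterval (by fun_prop)
  -- Integrating factor: `exp (α (t - a)) * (φ t - B / α)` is nonincreasing.
  have h := le_of_ae_deriv_nonpos hab (hE.mul (hφ.sub hc)) (by
    filter_upwards [hd] with t ht hmem
    obtain ⟨d, hd0, hd1⟩ := ht hmem
    have he : HasDerivAt (fun t => Real.exp (α * (t - a))) (Real.exp (α * (t - a)) * α) t := by
      have h1 : HasDerivAt (fun t : ℝ => α * (t - a)) α t := by
        simpa using ((hasDerivAt_id t).sub_const a).const_mul α
      exact h1.exp
    refine ⟨_, ?_, he.mul (hd1.sub (hasDerivAt_const t (B / α)))⟩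
    have : α * (φ t - B / α) + d ≤ 0 := by
      have : α * (B / α) = B := by field_simp
      linarith
    have h2 := mul_nonneg (Real.exp_pos (α * (t - a))).le (neg_nonneg.2 this)
    simp only [Pi.sub_apply]
    linarith)
  simp only [Pi.mul_apply, Pi.sub_apply, sub_self, mul_zero, Real.exp_zero, one_mul] at h
  have hexp : Real.exp (-α * (b - a)) * Real.exp (α * (b - a)) = 1 := by
    rw [← Real.exp_add]; simp
  have h3 := mul_le_mul_of_nonneg_left h (Real.exp_pos (-α * (b - a))).le
  rw [← mul_assoc, hexp] at h3
  have : 0 ≤ Real.exp (-α * (b - a)) * (B / α) := by positivity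
  linarith

end AbsolutelyContinuousOnInterval

/-! ### Global existence of Carathéodory solutions -/

namespace Caratheodory

open scoped NNReal BoundedContinuousFunction

variable {X U : Type*} [NormedAddCommGroup X] [NormedSpace ℝ X]

/-- The right-hand side of `x' = H (x, u t)` for `t ≥ 0`, along `x t = x₀ + exp (L t) • y t`,
switched off for `t < 0`. -/
noncomputable def integrand (H : X × U → X) (u : ℝ → U) (x₀ : X) (L : ℝ) (y : ℝ → X) : ℝ → X :=
  (Ici (0 : ℝ)).indicator fun s => H (x₀ + Real.exp (L * s) • y s, u s)

variable {H : X × U → X} {u : ℝ → U} {M : ℝ} {K : ℝ≥0} {x₀ : X} {L : ℝ}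

theorem norm_integrand_le (hM : ∀ p, ‖H p‖ ≤ M) (y : ℝ → X) (s : ℝ) :
    ‖integrand H u x₀ L y s‖ ≤ M :=
  (norm_indicator_le_norm_self _ _).trans (hM _)

theorem integral_integrand_of_nonpos (y : ℝ → X) {t : ℝ} (ht : t ≤ 0) :
    ∫ s in (0 : ℝ)..t, integrand H u x₀ L y s = 0 := by
  rw [intervalIntegral.integral_of_ge ht, integral_Ioc_eq_integral_Ioo, neg_eq_zero]
  refine setIntegral_eq_zero_of_forall_eq_zero fun s hs => ?_
  exact indicator_of_notMem (by simpa using hs.2) _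

variable [PseudoMetricSpace U]

theorem locallyIntegrable_integrand (hH : Continuous H) (hM : ∀ p, ‖H p‖ ≤ M)
    (hu : StronglyMeasurable u) {y : ℝ → X} (hy : Continuous y) :
    LocallyIntegrable (integrand H u x₀ L y) volume := by
  have hmeas : StronglyMeasurable (integrand H u x₀ L y) := by
    refine StronglyMeasurable.indicator ?_ measurableSet_Ici
    have h1 : StronglyMeasurable fun s => x₀ + Real.exp (L * s) • y s :=
      Continuous.stronglyMeasurable (by fun_prop)
    exact hH.comp_stronglyMeasurable (h1.prodMk hu)
  refine (locallyIntegrable_const M).mono hmeas.aestronglyMeasurable (ae_of_all _ fun s => ?_)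
  exact (norm_integrand_le hM y s).trans (le_abs_self M)

theorem lipschitzWith_integral (hH : Continuous H) (hM : ∀ p, ‖H p‖ ≤ M)
    (hu : StronglyMeasurable u) {y : ℝ → X} (hy : Continuous y) :
    LipschitzWith M.toNNReal fun t => ∫ s in (0 : ℝ)..t, integrand H u x₀ L y s := by
  have hM0 : 0 ≤ M := (norm_nonneg _).trans (hM (x₀, u 0))
  have hi := locallyIntegrable_integrand (x₀ := x₀) (L := L) hH hM hu hy
  have hint : ∀ a b, IntervalIntegrable (integrand H u x₀ L y) volume a b :=
    fun a b => (hi.integrableOn_isCompact isCompact_uIcc).intervalIntegrable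
  refine LipschitzWith.of_dist_le_mul fun t t' => ?_
  rw [dist_eq_norm, intervalIntegral.integral_interval_sub_left (hint _ _) (hint _ _),
    Real.coe_toNNReal _ hM0]
  exact intervalIntegral.norm_integral_le_of_norm_le_const fun s _ => norm_integrand_le hM y s

/-- The weighted Picard operator on bounded continuous functions. -/
noncomputable def picard (hH : Continuous H) (hM : ∀ p, ‖H p‖ ≤ M)
    (hu : StronglyMeasurable u) (x₀ : X) (hL : 0 < L) (y : ℝ →ᵇ X) : ℝ →ᵇ X :=
  BoundedContinuousFunction.ofNormedAddCommGroup
    (fun t => Real.exp (-(L * t)) • ∫ s in (0 : ℝ)..t, integrand H u x₀ L y s)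
    (by
      have := (lipschitzWith_integral (x₀ := x₀) (L := L) hH hM hu y.continuous).continuous
      fun_prop)
    -- The integral grows at most like `M t`, and `L t ≤ exp (L t)`.
    (M / L)
    (by
      intro t
      have hM0 : 0 ≤ M := (norm_nonneg _).trans (hM (x₀, u 0))
      rcases le_total t 0 with ht | ht
      · rw [integral_integrand_of_nonpos _ ht]
        simp only [smul_zero, norm_zero]
        positivity
      · rw [norm_smul, Real.norm_eq_abs, Real.abs_exp, Real.exp_neg]
        have h := intervalIntegral.norm_integral_le_of_norm_le_const (a := 0) (b := t)
          fun s _ => norm_integrand_le (u := u) (x₀ := x₀) (L := L) hM y s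
        rw [sub_zero, abs_of_nonneg ht] at h
        rw [inv_mul_le_iff₀ (Real.exp_pos _)]
        refine h.trans ?_
        have h2 : L * t ≤ Real.exp (L * t) := by linarith [Real.add_one_le_exp (L * t)]
        calc M * t = M / L * (L * t) := by field_simp
          _ ≤ M / L * Real.exp (L * t) := by gcongr
          _ = Real.exp (L * t) * (M / L) := mul_comm _ _)

/-- The integrands differ by at most `K * dist y z * exp (L s)`; integration gains `1 / L` and the
weight cancels the exponential. The contraction factor `K / L ≤ 1 / 2` is thus uniform in time, and
no continuation argument is needed. -/
theorem contractingWith_picard (hK : LipschitzWith K H) (hM : ∀ p, ‖H p‖ ≤ M)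
    (hu : StronglyMeasurable u) (x₀ : X) (hL : 0 < L) (hKL : 2 * (K : ℝ) ≤ L) :
    ContractingWith (1 / 2) (picard hK.continuous hM hu x₀ hL) := by
  refine ⟨by norm_num [← NNReal.coe_lt_coe], LipschitzWith.of_dist_le_mul fun y z => ?_⟩
  rw [BoundedContinuousFunction.dist_le (by positivity)]
  intro t
  have hint : ∀ w : ℝ →ᵇ X, IntervalIntegrable (integrand H u x₀ L w) volume 0 t := fun w =>
    ((locallyIntegrable_integrand hK.continuous hM hu w.continuous).integrableOn_isCompact
      isCompact_uIcc).intervalIntegrable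
  simp only [picard, BoundedContinuousFunction.coe_ofNormedAddCommGroup]
  rw [dist_eq_norm, ← smul_sub, ← intervalIntegral.integral_sub (hint y) (hint z)]
  rcases le_total t 0 with ht | ht
  · rw [intervalIntegral.integral_sub (hint y) (hint z), integral_integrand_of_nonpos _ ht,
      integral_integrand_of_nonpos _ ht]
    simp
  · have hbound : ∀ s ∈ Ioc 0 t, ‖integrand H u x₀ L y s - integrand H u x₀ L z s‖ ≤
        K * dist y z * Real.exp (L * s) := by
      intro s hs
      have hs0 : s ∈ Ici (0 : ℝ) := hs.1.le
      simp only [integrand, indicator_of_mem hs0]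
      rw [← dist_eq_norm]
      refine (hK.dist_le_mul _ _).trans ?_
      rw [Prod.dist_eq]
      simp only [dist_self, dist_add_left]
      rw [max_eq_left dist_nonneg, dist_smul₀, Real.norm_eq_abs, Real.abs_exp, mul_assoc,
        mul_comm (Real.exp _)]
      gcongr
      exact y.dist_coe_le_dist s
    have hderiv : ∀ s ∈ uIcc 0 t, HasDerivAt
        (fun s => K * dist y z / L * Real.exp (L * s)) (K * dist y z * Real.exp (L * s)) s := by
      intro s _
      have h1 : HasDerivAt (fun s : ℝ => L * s) L s := by
        simpa using (hasDerivAt_id s).const_mul L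
      convert! h1.exp.const_mul (K * dist y z / L) using 1
      field_simp
    have hI : IntervalIntegrable (fun s => K * dist y z * Real.exp (L * s)) volume 0 t :=
      Continuous.intervalIntegrable (by fun_prop) _ _
    have h := intervalIntegral.norm_integral_le_of_norm_le ht (ae_of_all _ hbound) hI
    rw [intervalIntegral.integral_eq_sub_of_hasDerivAt hderiv hI] at h
    rw [norm_smul, Real.norm_eq_abs, Real.abs_exp, Real.exp_neg, inv_mul_le_iff₀ (Real.exp_pos _)]
    refine h.trans ?_
    have hd : 0 ≤ dist y z := dist_nonneg
    have h1 : (K : ℝ) * dist y z / L ≤ 1 / 2 * dist y z := by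
      rw [div_le_iff₀ hL]
      nlinarith
    have h2 : 0 ≤ (K : ℝ) * dist y z / L := by positivity
    have h3 := mul_le_mul_of_nonneg_right h1 (Real.exp_pos (L * t)).le
    simp only [mul_zero, Real.exp_zero, mul_one, NNReal.coe_div, NNReal.coe_one, NNReal.coe_ofNat]
    linarith

/-- Global existence of Carathéodory solutions of `x' = H (x, u t)` for a bounded Lipschitz
field `H` and a measurable input `u`. -/
theorem exists_solution [CompleteSpace X] (hK : LipschitzWith K H) (hM : ∀ p, ‖H p‖ ≤ M)
    (hu : StronglyMeasurable u) (x₀ : X) :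
    ∃ x : ℝ → X, x 0 = x₀ ∧ LipschitzWith M.toNNReal x ∧
      ∀ᵐ t, 0 ≤ t → HasDerivAt x (H (x t, u t)) t := by
  -- The summand `1` keeps the weight positive when `K = 0`.
  have hL : 0 < 2 * (K : ℝ) + 1 := by positivity
  have hc := contractingWith_picard hK hM hu x₀ hL (by linarith)
  set L := 2 * (K : ℝ) + 1
  set y := ContractingWith.fixedPoint _ hc
  have hy : ∀ t, y t = Real.exp (-(L * t)) • ∫ s in (0 : ℝ)..t, integrand H u x₀ L y s :=
    fun t => (DFunLike.congr_fun hc.fixedPoint_isFixedPt.eq t).symm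
  have hxy : ∀ t, Real.exp (L * t) • y t = ∫ s in (0 : ℝ)..t, integrand H u x₀ L y s := by
    intro t
    rw [hy t, smul_smul, ← Real.exp_add]
    simp
  refine ⟨fun t => x₀ + ∫ s in (0 : ℝ)..t, integrand H u x₀ L y s, by simp, ?_, ?_⟩
  · have h := lipschitzWith_integral (x₀ := x₀) (L := L) hK.continuous hM hu y.continuous
    refine LipschitzWith.of_dist_le_mul fun t t' => ?_
    rw [dist_add_left]
    exact h.dist_le_mul t t'
  · filter_upwards [LocallyIntegrable.ae_hasDerivAt_integral (locallyIntegrable_integrand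
      (x₀ := x₀) (L := L) hK.continuous hM hu y.continuous)] with t ht ht0
    have h := (ht 0).const_add x₀
    have hmem : t ∈ Ici (0 : ℝ) := ht0
    rw [integrand, indicator_of_mem hmem, hxy t] at h
    exact h

end Caratheodory

/-! ### Algebra of the cross product, the kinematic matrix and the inertia operator -/

namespace AttitudeLoop

open scoped RealInnerProductSpace

/-- The cross product `w × x`. -/
noncomputable def cross (w x : E3) : E3 := WithLp.toLp 2 (skew w *ᵥ x.ofLp)

/-- The action `E(q) v` of the kinematic matrix. -/
noncomputable def kin (q : Quat) (v : E3) : Quat := WithLp.toLp 2 (kinMatrix q *ᵥ v.ofLp)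

/-- The imaginary part as a continuous linear map. -/
noncomputable def imPartL : Quat →L[ℝ] E3 :=
  LinearMap.toContinuousLinearMap
    { toFun := imPart
      map_add' := fun x y => by ext i; fin_cases i <;> simp [imPart]
      map_smul' := fun r x => by ext i; fin_cases i <;> simp [imPart] }

theorem imPartL_apply (q : Quat) : imPartL q = imPart q := rfl

theorem inner_eq (x y : E3) : ⟪x, y⟫ = x 0 * y 0 + x 1 * y 1 + x 2 * y 2 := by
  simp [PiLp.inner_apply, Fin.sum_univ_three, mul_comm]

theorem norm_sq_eq (x : E3) : ‖x‖ ^ 2 = x 0 ^ 2 + x 1 ^ 2 + x 2 ^ 2 := by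
  simp [EuclideanSpace.norm_sq_eq, Fin.sum_univ_three]

theorem quat_norm_sq_eq (q : Quat) : ‖q‖ ^ 2 = q 0 ^ 2 + ‖imPart q‖ ^ 2 := by
  simp [EuclideanSpace.norm_sq_eq, Fin.sum_univ_four, Fin.sum_univ_three, imPart]
  ring

theorem kin_zero (q : Quat) (v : E3) : kin q v 0 = -⟪imPart q, v⟫ := by
  simp [kin, kinMatrix, inner_eq, imPart, Matrix.mulVec, dotProduct, Fin.sum_univ_three]
  ring

theorem kin_one (q : Quat) (v : E3) : kin q v 1 = q 0 * v 0 + q 3 * v 1 - q 2 * v 2 := by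
  simp [kin, kinMatrix, Matrix.mulVec, dotProduct, Fin.sum_univ_three]
  ring

theorem kin_two (q : Quat) (v : E3) : kin q v 2 = -q 3 * v 0 + q 0 * v 1 + q 1 * v 2 := by
  simp [kin, kinMatrix, Matrix.mulVec, dotProduct, Fin.sum_univ_three]

theorem kin_three (q : Quat) (v : E3) : kin q v 3 = q 2 * v 0 - q 1 * v 1 + q 0 * v 2 := by
  simp [kin, kinMatrix, Matrix.mulVec, dotProduct, Fin.sum_univ_three]
  ring

theorem cross_zero (w x : E3) : cross w x 0 = w 1 * x 2 - w 2 * x 1 := by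
  simp [cross, skew, dotProduct, Fin.sum_univ_three]
  ring

theorem cross_one (w x : E3) : cross w x 1 = w 2 * x 0 - w 0 * x 2 := by
  simp [cross, skew, dotProduct, Fin.sum_univ_three]
  ring

theorem cross_two (w x : E3) : cross w x 2 = w 0 * x 1 - w 1 * x 0 := by
  simp [cross, skew, dotProduct, Fin.sum_univ_three]
  ring

theorem inner_cross_self (w x : E3) : ⟪w, cross w x⟫ = 0 := by
  rw [inner_eq, cross_zero, cross_one, cross_two]
  ring

theorem cross_self (w : E3) : cross w w = 0 := by
  ext i
  fin_cases i
  · simpa [cross_zero] using by ring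
  · simpa [cross_one] using by ring
  · simpa [cross_two] using by ring

/-- Lagrange's identity: the squares differ by `⟪w, x⟫ ^ 2`. -/
theorem norm_cross_le (w x : E3) : ‖cross w x‖ ≤ ‖w‖ * ‖x‖ := by
  refine le_of_sq_le_sq ?_ (by positivity)
  rw [mul_pow, norm_sq_eq, norm_sq_eq, norm_sq_eq, cross_zero, cross_one, cross_two]
  nlinarith [sq_nonneg (w 0 * x 0 + w 1 * x 1 + w 2 * x 2)]

/-- The columns of `E(q)` are orthogonal to `q`; this is why the unit sphere is invariant for every
input. -/
theorem inner_kin_self (q : Quat) (v : E3) : ⟪q, kin q v⟫ = 0 := by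
  simp only [PiLp.inner_apply, Fin.sum_univ_four, kin_zero, kin_one, kin_two, kin_three,
    imPart, RCLike.inner_apply, conj_trivial]
  simp [Fin.sum_univ_three]
  ring

/-- The gap between the squares is `⟪imPart q, v⟫ ^ 2`, the squared real part of `kin q v`. -/
theorem norm_imPart_kin_le (q : Quat) (v : E3) : ‖imPart (kin q v)‖ ≤ ‖q‖ * ‖v‖ := by
  refine le_of_sq_le_sq ?_ (by positivity)
  rw [mul_pow, quat_norm_sq_eq, norm_sq_eq, norm_sq_eq, norm_sq_eq]
  simp only [imPart, kin_one, kin_two, kin_three]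
  simp
  nlinarith [sq_nonneg (q 1 * v 0 + q 2 * v 1 + q 3 * v 2)]

theorem contDiff_kin : ContDiff ℝ 1 fun p : Quat × E3 => kin p.1 p.2 := by
  rw [contDiff_euclidean]
  intro i
  fin_cases i
  · simp only [Fin.zero_eta, kin_zero, inner_eq, imPart]
    simp
    fun_prop
  · simp only [Fin.mk_one, kin_one]
    fun_prop
  · simp only [Fin.reduceFinMk, kin_two]
    fun_prop
  · simp only [Fin.reduceFinMk, kin_three]
    fun_prop

theorem contDiff_cross : ContDiff ℝ 1 fun p : E3 × E3 => cross p.1 p.2 := by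
  rw [contDiff_euclidean]
  intro i
  fin_cases i
  · simp only [Fin.zero_eta, cross_zero]
    fun_prop
  · simp only [Fin.mk_one, cross_one]
    fun_prop
  · simp only [Fin.reduceFinMk, cross_two]
    fun_prop

/-- The inertia matrix as an operator on `ℝ³`. -/
noncomputable abbrev inertia (J : Matrix (Fin 3) (Fin 3) ℝ) : E3 →L[ℝ] E3 := Matrix.toEuclideanCLM (𝕜 := ℝ) J

theorem inertia_symm {J : Matrix (Fin 3) (Fin 3) ℝ} (hJ : J.PosDef) (x y : E3) :
    ⟪inertia J x, y⟫ = ⟪x, inertia J y⟫ := by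
  rw [real_inner_comm, Matrix.inner_toEuclideanCLM, Matrix.inner_toEuclideanCLM,
    Matrix.dotProduct_mulVec, ← Matrix.mulVec_transpose, dotProduct_comm]
  have : Jᵀ = J := by simpa using hJ.isHermitian.eq
  rw [this]

/-- `μ` is the minimum of the quadratic form on the compact unit sphere, extended by homogeneity.
`N` is the operator norm, enlarged if necessary to dominate `μ`. -/
theorem exists_inertia_bounds {J : Matrix (Fin 3) (Fin 3) ℝ} (hJ : J.PosDef) :
    ∃ μ N : ℝ, 0 < μ ∧ μ ≤ N ∧ (∀ x, μ * ‖x‖ ^ 2 ≤ ⟪x, inertia J x⟫) ∧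
      ∀ x, ‖inertia J x‖ ≤ N * ‖x‖ := by
  obtain ⟨x₀, hx₀, hmin⟩ := (isCompact_sphere (0 : E3) 1).exists_isMinOn
    (NormedSpace.sphere_nonempty.2 zero_le_one)
    (f := fun x => ⟪x, inertia J x⟫) (Continuous.continuousOn (by fun_prop))
  have hx₀' : ‖x₀‖ = 1 := by simpa using hx₀
  have hpos : 0 < ⟪x₀, inertia J x₀⟫ := by
    rw [Matrix.inner_toEuclideanCLM]
    have hne : x₀.ofLp ≠ 0 := by
      intro h
      have : x₀ = 0 := by ext i; simp [h]
      simp [this] at hx₀'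
    simpa using hJ.dotProduct_mulVec_pos hne
  refine ⟨_, max ⟪x₀, inertia J x₀⟫ ‖inertia J‖, hpos, le_max_left _ _, fun x => ?_, fun x => ?_⟩
  · rcases eq_or_ne x 0 with rfl | hx
    · simp
    · have hn : 0 < ‖x‖ := norm_pos_iff.2 hx
      have h := hmin (a := ‖x‖⁻¹ • x) (by simp [norm_smul, hn.ne'])
      simp only [mem_ofPred_eq, map_smul, inner_smul_left, inner_smul_right, conj_trivial] at h
      calc _ ≤ ‖x‖⁻¹ * (‖x‖⁻¹ * ⟪x, inertia J x⟫) * ‖x‖ ^ 2 := by gcongr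
        _ = ⟪x, inertia J x⟫ := by field_simp
  · refine ((inertia J).le_opNorm x).trans ?_
    gcongr
    exact le_max_right _ _

theorem inner_inertia_le {J : Matrix (Fin 3) (Fin 3) ℝ} {N : ℝ}
    (hN : ∀ x, ‖inertia J x‖ ≤ N * ‖x‖) (x : E3) : ⟪x, inertia J x⟫ ≤ N * ‖x‖ ^ 2 := by
  refine (real_inner_le_norm _ _).trans ?_
  linarith [mul_le_mul_of_nonneg_left (hN x) (norm_nonneg x)]

/-! ### Regularity of solutions and conservation of the quaternion norm -/

variable {J : Matrix (Fin 3) (Fin 3) ℝ} {Kp Kd : ℝ} {u : ℝ → E3} {q : ℝ → Quat} {w : ℝ → E3}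

theorem IsSolution.ae_hasDerivAt (h : IsSolution J Kp Kd u q w) :
    ∀ᵐ t, 0 ≤ t → HasDerivAt q ((1 / 2 : ℝ) • kin (q t) (u t - w t)) t ∧
      ∃ w', HasDerivAt w w' t ∧ inertia J w' =
        -cross (w t) (inertia J (w t)) + (Kp • imPart (q t) - Kd • w t) := by
  have h1 := h.kinematics
  have h2 := h.euler
  rw [ae_restrict_iff' measurableSet_Ici] at h1 h2
  filter_upwards [h1, h2] with t h1 h2 ht
  obtain ⟨w', hw', he⟩ := h2 ht
  exact ⟨h1 ht, w', hw', (WithLp.ofLp_injective 2) he⟩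

theorem IsSolution.absCont_comp (h : IsSolution J Kp Kd u q w) {V : Quat × E3 → ℝ}
    (hV : ContDiff ℝ 1 V) {a b : ℝ} (ha : 0 ≤ a) (hab : a ≤ b) :
    AbsolutelyContinuousOnInterval (fun t => V (q t, w t)) a b := by
  refine (((h.absCont_q b (ha.trans hab)).prodMk (h.absCont_w b (ha.trans hab))).comp_contDiff
    hV).mono ?_
  rw [uIcc_of_le hab, uIcc_of_le (ha.trans hab)]
  exact Icc_subset_Icc_left ha

theorem hasDerivAt_norm_sq {x : ℝ → Quat} {r : ℝ} {v : E3} {t : ℝ}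
    (h : HasDerivAt x (r • kin (x t) v) t) : HasDerivAt (fun t => ‖x t‖ ^ 2) 0 t := by
  convert! h.norm_sq using 1
  rw [inner_smul_right, inner_kin_self]
  ring

/-- The squared norm has zero derivative almost everywhere. The free factor `r t` lets the same
statement serve the loop cut off by a bump function. -/
theorem norm_eq_one_of_ae_hasDerivAt {x : ℝ → Quat} {r : ℝ → ℝ} {v : ℝ → E3} {T : ℝ}
    (hT : 0 ≤ T) (h0 : ‖x 0‖ = 1) (hx : AbsolutelyContinuousOnInterval x 0 T)
    (hd : ∀ᵐ t, 0 ≤ t → HasDerivAt x (r t • kin (x t) (v t)) t) : ‖x T‖ = 1 := by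
  have hac : AbsolutelyContinuousOnInterval (fun t => ‖x t‖ ^ 2) 0 T :=
    hx.comp_contDiff (g := fun y : Quat => ‖y‖ ^ 2) (contDiff_norm_sq ℝ)
  have h1 : ‖x T‖ ^ 2 ≤ ‖x 0‖ ^ 2 := hac.le_of_ae_deriv_nonpos hT (by
    filter_upwards [hd] with t ht hmem
    exact ⟨0, le_rfl, hasDerivAt_norm_sq (ht hmem.1.le)⟩)
  have h2 : -‖x T‖ ^ 2 ≤ -‖x 0‖ ^ 2 :=
      hac.fun_neg.le_of_ae_deriv_nonpos (φ := fun t => -‖x t‖ ^ 2) hT (by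
    filter_upwards [hd] with t ht hmem
    exact ⟨-0, by simp, (hasDerivAt_norm_sq (ht hmem.1.le)).neg⟩)
  rw [h0] at h1 h2
  have : ‖x T‖ ^ 2 = 1 := by linarith
  exact (pow_eq_one_iff_of_nonneg (norm_nonneg _) two_ne_zero).1 this

theorem IsSolution.norm_eq_one (h : IsSolution J Kp Kd u q w) {t : ℝ} (ht : 0 ≤ t) :
    ‖q t‖ = 1 :=
  norm_eq_one_of_ae_hasDerivAt ht h.unit_init (h.absCont_q t ht)
    (h.ae_hasDerivAt.mono fun _ hs hs0 => (hs hs0).1)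

/-! ### The Lyapunov function and its dissipation -/

/-- The Lyapunov function: the energy `½ ⟪w, J w⟫ + 2 k² (1 - q₀)` with a cross term of
weight `l`. -/
noncomputable def lyap (J : Matrix (Fin 3) (Fin 3) ℝ) (k l : ℝ) (p : Quat × E3) : ℝ :=
  1 / 2 * ⟪p.2, inertia J p.2⟫ + 2 * k ^ 2 * (1 - p.1 0) - l * k * ⟪imPartL p.1, inertia J p.2⟫

theorem contDiff_lyap (J : Matrix (Fin 3) (Fin 3) ℝ) (k l : ℝ) : ContDiff ℝ 1 (lyap J k l) := by
  have h1 : ContDiff ℝ 1 fun p : Quat × E3 => ⟪p.2, inertia J p.2⟫ :=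
    ContDiff.inner ℝ (by fun_prop) (by fun_prop)
  have h2 : ContDiff ℝ 1 fun p : Quat × E3 => ⟪imPartL p.1, inertia J p.2⟫ :=
    ContDiff.inner ℝ (by fun_prop) (by fun_prop)
  unfold lyap
  fun_prop

/-- Symmetry of `J` merges the two halves of the kinetic term. Only `J w'` appears, which is what
Euler's equation provides, so `J` need not be inverted. -/
theorem hasDerivAt_lyap (hJ : J.PosDef) (k l : ℝ) {q' : Quat} {w' : E3} {t : ℝ}
    (hq : HasDerivAt q q' t) (hw : HasDerivAt w w' t) :
    HasDerivAt (fun t => lyap J k l (q t, w t))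
      (⟪w t, inertia J w'⟫ - 2 * k ^ 2 * q' 0 -
        l * k * (⟪imPart (q t), inertia J w'⟫ + ⟪imPart q', inertia J (w t)⟫)) t := by
  have hAw := (inertia J).hasFDerivAt.comp_hasDerivAt t hw
  have h1 := (hw.inner ℝ hAw).const_mul (1 / 2)
  have h2 := (((EuclideanSpace.proj (𝕜 := ℝ) (0 : Fin 4)).hasFDerivAt.comp_hasDerivAt t
    hq).const_sub 1).const_mul (2 * k ^ 2)
  have h3 := ((imPartL.hasFDerivAt.comp_hasDerivAt t hq).inner ℝ hAw).const_mul (l * k)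
  have h := (h1.add h2).sub h3
  refine h.congr_deriv ?_
  have hs : ⟪w', inertia J (w t)⟫ = ⟪w t, inertia J w'⟫ := by
    rw [← inertia_symm hJ, real_inner_comm]
  simp only [Function.comp_apply, imPartL_apply, hs, PiLp.proj_apply]
  ring

theorem norm_imPart_le (p : Quat) : ‖imPart p‖ ≤ ‖p‖ := by
  refine le_of_sq_le_sq ?_ (norm_nonneg _)
  rw [quat_norm_sq_eq]
  nlinarith [sq_nonneg (p 0)]

theorem abs_zero_le_one {p : Quat} (hp : ‖p‖ = 1) : |p 0| ≤ 1 := by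
  have h := quat_norm_sq_eq p
  rw [hp] at h
  exact abs_le_one_iff_mul_self_le_one.2 (by nlinarith [sq_nonneg ‖imPart p‖])

/-- Weighted bound of the cross term. -/
theorem abs_cross_term_le {N μ η l k : ℝ} (hμ : 0 < μ) (hk : 0 < k) (hl : 0 ≤ l)
    (hlη : 2 * l ^ 2 * N ^ 2 ≤ η * μ) (hN : ∀ x, ‖inertia J x‖ ≤ N * ‖x‖) {p : Quat}
    (hp : ‖p‖ = 1) (x : E3) :
    |l * k * ⟪imPart p, inertia J x⟫| ≤ μ / 4 * ‖x‖ ^ 2 + η * (k ^ 2 * (1 - p 0)) := by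
  have hsq := quat_norm_sq_eq p
  rw [hp] at hsq
  have h0 := abs_le.1 (abs_zero_le_one hp)
  set z := ‖imPart p‖
  -- On the unit sphere `z ^ 2 = (1 - p 0) * (1 + p 0)`.
  have hz : z ^ 2 ≤ 2 * (1 - p 0) := by nlinarith
  have h1 : |l * k * ⟪imPart p, inertia J x⟫| ≤ l * k * (z * (N * ‖x‖)) := by
    rw [abs_mul, abs_of_nonneg (by positivity : 0 ≤ l * k)]
    gcongr
    exact (abs_real_inner_le_norm _ _).trans (by gcongr; exact hN x)
  refine h1.trans ?_
  have h2 : l * k * (z * (N * ‖x‖)) ≤ μ / 4 * ‖x‖ ^ 2 + (l * N * k * z) ^ 2 / μ := by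
    have : μ / 4 * ‖x‖ ^ 2 + (l * N * k * z) ^ 2 / μ - l * k * (z * (N * ‖x‖)) =
        (μ / 2 * ‖x‖ - l * N * k * z) ^ 2 / μ := by
      field_simp
      ring
    have : 0 ≤ (μ / 2 * ‖x‖ - l * N * k * z) ^ 2 / μ := by positivity
    linarith
  have h3 : (l * N * k * z) ^ 2 / μ ≤ η * (k ^ 2 * (1 - p 0)) := by
    rw [div_le_iff₀ hμ]
    have h4 : (l * N * k * z) ^ 2 ≤ (l * N * k) ^ 2 * (2 * (1 - p 0)) := by
      rw [mul_pow (l * N * k) z]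
      gcongr
    have h5 : 2 * l ^ 2 * N ^ 2 * (k ^ 2 * (1 - p 0)) ≤ η * μ * (k ^ 2 * (1 - p 0)) := by
      have : 0 ≤ k ^ 2 * (1 - p 0) := mul_nonneg (by positivity) (by linarith)
      gcongr
    linarith
  linarith

/-- The scalar estimate behind the dissipation inequality. -/
theorem dissipation_bound {c N l a z k U D : ℝ} (hc : 0 < c) (hN : 0 < N) (hl : 0 < l)
    (hk : 0 < k) (hz1 : z ≤ 1)
    (hlN : 12 * l * N ≤ c) (hlc : 8 * l * c ≤ 1)
    (hD : D ≤ -(c * k) * a ^ 2 + k ^ 2 * (z * U) + l * k * (1 / 2 * (U + a) * (N * a))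
      + l * k * (z * (a * (N * a))) - l * k * (k ^ 2 * z ^ 2) + l * k * (c * k * (z * a))) :
    D ≤ k * (-(c / 2) * a ^ 2 - l / 2 * (k * z) ^ 2 + (1 / l + c / 8) * U ^ 2) := by
  -- Young budget, after factoring out `k`: `h1` and `h2` spend half of the available `l (k z)²`;
  -- `h2`, `h3` and `h4` spend `13c/48` of the available `c a²`, less than half; `U²` collects `1/l
  -- + c/48`.
  have h1 : (k * z) * U ≤ l / 4 * (k * z) ^ 2 + 1 / l * U ^ 2 := by
    have : l / 4 * (k * z) ^ 2 + 1 / l * U ^ 2 - (k * z) * U = (l * (k * z) / 2 - U) ^ 2 / l := by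
      field_simp
      ring
    have : 0 ≤ (l * (k * z) / 2 - U) ^ 2 / l := by positivity
    linarith
  have h2 : l * c * ((k * z) * a) ≤ l / 4 * (k * z) ^ 2 + c / 8 * a ^ 2 := by
    have h3 : l * c * ((k * z) * a) ≤ l / 4 * (k * z) ^ 2 + l * c ^ 2 * a ^ 2 := by
      nlinarith [mul_nonneg hl.le (sq_nonneg (k * z / 2 - c * a))]
    have : l * c ^ 2 * a ^ 2 ≤ c / 8 * a ^ 2 := by
      gcongr
      nlinarith
    linarith
  have h3 : l * (1 / 2 * U * (N * a)) ≤ c / 48 * a ^ 2 + c / 48 * U ^ 2 := by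
    have : l * N * (a ^ 2 + U ^ 2) ≤ c / 12 * (a ^ 2 + U ^ 2) := by
      gcongr
      linarith
    nlinarith [mul_nonneg (mul_nonneg hl.le hN.le) (sq_nonneg (U - a))]
  have h4 : l * (1 / 2 * a * (N * a)) + l * (z * (a * (N * a))) ≤ c / 8 * a ^ 2 := by
    have h5 : z * (l * N * a ^ 2) ≤ 1 * (l * N * a ^ 2) := by gcongr
    have h6 : l * N * a ^ 2 ≤ c / 12 * a ^ 2 := by
      gcongr
      linarith
    linarith
  have h7 : 0 ≤ c * a ^ 2 := by positivity
  have h8 : 0 ≤ c * U ^ 2 := by positivity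
  calc D ≤ _ := hD
    _ = k * (-c * a ^ 2 + (k * z) * U + l * (1 / 2 * U * (N * a)) + (l * (1 / 2 * a * (N * a))
      + l * (z * (a * (N * a)))) - l * (k * z) ^ 2 + l * c * ((k * z) * a)) := by ring
    _ ≤ _ := by
      refine mul_le_mul_of_nonneg_left ?_ hk.le
      linarith

/-- The gyroscopic term is orthogonal to `x`, and `k²⟪imPart p, x⟫` cancels between kinetic and
potential energy. What remains indefinite is bounded by Cauchy–Schwarz and passed to
`dissipation_bound`. -/
theorem lyap_deriv_le {c N l k : ℝ} (hc : 0 < c) (hN0 : 0 < N) (hl : 0 < l)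
    (hk : 0 < k) (hlN : 12 * l * N ≤ c) (hlc : 8 * l * c ≤ 1)
    (hN : ∀ x, ‖inertia J x‖ ≤ N * ‖x‖) {p : Quat} (hp : ‖p‖ = 1) {x v x' : E3}
    (hx' : inertia J x' = -cross x (inertia J x) + (k ^ 2 • imPart p - (c * k) • x)) :
    ⟪x, inertia J x'⟫ - 2 * k ^ 2 * ((1 / 2 : ℝ) • kin p (v - x)) 0 -
        l * k * (⟪imPart p, inertia J x'⟫ +
          ⟪imPart ((1 / 2 : ℝ) • kin p (v - x)), inertia J x⟫) ≤
      k * (-(c / 2) * ‖x‖ ^ 2 - l / 2 * (k * ‖imPart p‖) ^ 2 + (1 / l + c / 8) * ‖v‖ ^ 2) := by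
  have hz1 : ‖imPart p‖ ≤ 1 := hp ▸ norm_imPart_le p
  refine dissipation_bound hc hN0 hl hk hz1 hlN hlc ?_
  rw [← imPartL_apply ((1 / 2 : ℝ) • kin p (v - x)), map_smul, imPartL_apply, hx']
  simp only [PiLp.smul_apply, smul_eq_mul, kin_zero, inner_add_right, inner_sub_right,
    inner_neg_right, inner_smul_right, inner_smul_left, inner_cross_self, conj_trivial,
    real_inner_self_eq_norm_sq, real_inner_comm (imPart p) x]
  have h1 : ⟪imPart p, v⟫ ≤ ‖imPart p‖ * ‖v‖ := real_inner_le_norm _ _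
  have h2 : ⟪imPart p, x⟫ ≤ ‖imPart p‖ * ‖x‖ := real_inner_le_norm _ _
  have h3 : ⟪imPart p, cross x (inertia J x)⟫ ≤ ‖imPart p‖ * (‖x‖ * (N * ‖x‖)) := by
    refine (real_inner_le_norm _ _).trans ?_
    gcongr
    refine (norm_cross_le _ _).trans ?_
    gcongr
    exact hN x
  have h4 : -⟪imPart (kin p (v - x)), inertia J x⟫ ≤ (‖v‖ + ‖x‖) * (N * ‖x‖) := by
    refine (neg_le_abs _).trans ((abs_real_inner_le_norm _ _).trans ?_)
    gcongr
    · refine (norm_imPart_kin_le _ _).trans ?_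
      rw [hp, one_mul]
      exact norm_sub_le _ _
    · exact hN x
  have e1 := mul_le_mul_of_nonneg_left h1 (by positivity : 0 ≤ k ^ 2)
  have e2 := mul_le_mul_of_nonneg_left h2 (by positivity : 0 ≤ l * k * (c * k))
  have e3 := mul_le_mul_of_nonneg_left h3 (by positivity : 0 ≤ l * k)
  have e4 := mul_le_mul_of_nonneg_left h4 (by positivity : 0 ≤ l * k * (1 / 2))
  linarith

/-- A Lyapunov function with quadratic bounds, whose cross term is as small as prescribed by `η`,
and its dissipation along the solutions with `1 + q₀ ≥ m`. All constants are independent of the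
gain `k = √K_p`. -/
theorem exists_lyapunov {J : Matrix (Fin 3) (Fin 3) ℝ} (hJ : J.PosDef) {c m η : ℝ} (hc : 0 < c)
    (hm : 0 < m) (hη : 0 < η) (hη1 : η ≤ 1) :
    ∃ μ N α G : ℝ, 0 < μ ∧ 0 < N ∧ 0 < α ∧ 0 < G ∧ ∀ k : ℝ, 0 < k → ∃ V : Quat × E3 → ℝ,
      (∀ p x, ‖p‖ = 1 → μ * ‖x‖ ^ 2 + (2 - η) * (k ^ 2 * (1 - p 0)) ≤ V (p, x) ∧
        V (p, x) ≤ N * ‖x‖ ^ 2 + (2 + η) * (k ^ 2 * (1 - p 0))) ∧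
      ∀ u q w, IsSolution J (k ^ 2) (c * k) u q w → ∀ a b U : ℝ, 0 ≤ a → a ≤ b → 0 ≤ U →
        (∀ t ∈ Icc a b, m ≤ 1 + q t 0) → (∀ᵐ t, t ∈ Icc a b → ‖u t‖ ≤ U) →
        V (q b, w b) ≤ Real.exp (-(k * α) * (b - a)) * V (q a, w a) + G / α * U ^ 2 := by
  obtain ⟨μ, N, hμ, hμN, hlow, hup⟩ := exists_inertia_bounds hJ
  have hN : 0 < N := hμ.trans_le hμN
  -- The first two upper bounds are the hypotheses of `dissipation_bound`; the last two give `2 l²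
  -- N² ≤ η μ`, which makes the cross term small.
  obtain ⟨l, hl, hlN, hlc, hl1, hlη⟩ : ∃ l : ℝ, 0 < l ∧ l ≤ c / (12 * N) ∧ l ≤ 1 / (8 * c) ∧
      l ≤ 1 ∧ l ≤ η * μ / (2 * N ^ 2) := by
    refine ⟨min (min (c / (12 * N)) (1 / (8 * c))) (min 1 (η * μ / (2 * N ^ 2))), by positivity,
      ?_, ?_, ?_, ?_⟩ <;> simp
  rw [le_div_iff₀ (by positivity)] at hlN hlc hlη
  have hlη' : 2 * l ^ 2 * N ^ 2 ≤ η * μ := by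
    have : l * (l * (2 * N ^ 2)) ≤ 1 * (l * (2 * N ^ 2)) := by gcongr
    linarith
  -- Chosen so that `α V`, with `V ≤ N‖w‖² + 3k²(1 - q₀)` by `η ≤ 1`, is absorbed by the two
  -- dissipation terms.
  obtain ⟨α, hα, hαN, hαm⟩ : ∃ α : ℝ, 0 < α ∧ α ≤ c / (2 * N) ∧ α ≤ l * m / 6 :=
    ⟨min (c / (2 * N)) (l * m / 6), by positivity, min_le_left _ _, min_le_right _ _⟩
  rw [le_div_iff₀ (by positivity)] at hαN
  refine ⟨μ / 4, N, α, 1 / l + c / 8, by positivity, hN, hα, by positivity, fun k hk =>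
    ⟨lyap J k l, ?_, ?_⟩⟩
  · intro p x hp
    have h1 := abs_le.1 (abs_cross_term_le hμ hk hl.le hlη' hup hp x)
    have h2 := hlow x
    have h3 := inner_inertia_le hup x
    have h4 : μ * ‖x‖ ^ 2 ≤ N * ‖x‖ ^ 2 := by gcongr
    have h5 : 0 ≤ N * ‖x‖ ^ 2 := by positivity
    simp only [lyap, imPartL_apply]
    constructor <;> linarith [h1.1, h1.2]
  · intro u q w hsol a b U ha hab hU hq hu
    have hac := hsol.absCont_comp (contDiff_lyap J k l) ha hab
    have h := hac.le_exp_mul_add_of_ae_deriv_le (α := k * α) (B := k * ((1 / l + c / 8) * U ^ 2))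
      hab (by positivity) (by positivity) ?_
    · refine h.trans_eq ?_
      congr 1
      field_simp
    filter_upwards [hsol.ae_hasDerivAt, hu] with t ht hut hmem
    have ht0 : 0 ≤ t := ha.trans hmem.1.le
    have hmem' : t ∈ Icc a b := Ioc_subset_Icc_self hmem
    obtain ⟨hq', w', hw', hE⟩ := ht ht0
    refine ⟨_, ?_, hasDerivAt_lyap hJ k l hq' hw'⟩
    have hn := hsol.norm_eq_one ht0
    refine (lyap_deriv_le hc hN hl hk (by linarith) (by linarith) hup hn hE).trans ?_
    have hV : lyap J k l (q t, w t) ≤ N * ‖w t‖ ^ 2 + 3 * (k ^ 2 * (1 - q t 0)) := by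
      have h1 := abs_le.1 (abs_cross_term_le hμ hk hl.le hlη' hup hn (w t))
      have h3 := inner_inertia_le hup (w t)
      have h4 : μ * ‖w t‖ ^ 2 ≤ N * ‖w t‖ ^ 2 := by gcongr
      have h5 : 0 ≤ N * ‖w t‖ ^ 2 := by positivity
      have h6 : η * (k ^ 2 * (1 - q t 0)) ≤ 1 * (k ^ 2 * (1 - q t 0)) := by
        have := abs_le.1 (abs_zero_le_one hn)
        have : 0 ≤ 1 - q t 0 := by linarith
        gcongr
      simp only [lyap, imPartL_apply]
      linarith [h1.1]
    have hα1 : α * (N * ‖w t‖ ^ 2) ≤ c / 2 * ‖w t‖ ^ 2 := by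
      rw [← mul_assoc]
      gcongr
      linarith
    -- Here the angle restriction enters: `m ≤ 1 + q₀` bounds `‖q_v‖²` below by `m (1 - q₀)`.
    have hα2 : α * (3 * (k ^ 2 * (1 - q t 0))) ≤ l / 2 * (k * ‖imPart (q t)‖) ^ 2 := by
      have hsq := quat_norm_sq_eq (q t)
      rw [hn] at hsq
      have h0 := abs_le.1 (abs_zero_le_one hn)
      have h1 : 0 ≤ 1 - q t 0 := by linarith
      calc α * (3 * (k ^ 2 * (1 - q t 0))) ≤ l * m / 6 * (3 * (k ^ 2 * (1 - q t 0))) := by gcongr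
        _ = l / 2 * (k ^ 2 * ((1 - q t 0) * m)) := by ring
        _ ≤ l / 2 * (k ^ 2 * ((1 - q t 0) * (1 + q t 0))) := by
          gcongr
          exact hq t hmem'
        _ = l / 2 * (k * ‖imPart (q t)‖) ^ 2 := by
          rw [mul_pow]
          congr 2
          linarith
    have hu2 : (1 / l + c / 8) * ‖u t‖ ^ 2 ≤ (1 / l + c / 8) * U ^ 2 := by
      gcongr
      exact hut hmem'
    have h8 := mul_le_mul_of_nonneg_left hV hα.le
    calc _ ≤ k * (-α * lyap J k l (q t, w t) + (1 / l + c / 8) * U ^ 2) :=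
          mul_le_mul_of_nonneg_left (by linarith) hk.le
      _ = _ := by ring

/-! ### The error angle and input-to-state stability -/

theorem errAngle_nonneg (p : Quat) : 0 ≤ errAngle p :=
  mul_nonneg zero_le_two (Real.arccos_nonneg _)

theorem errAngle_le_two_pi (p : Quat) : errAngle p ≤ 2 * Real.pi :=
  mul_le_mul_of_nonneg_left (Real.arccos_le_pi _) zero_le_two

theorem cos_half_errAngle {p : Quat} (hp : ‖p‖ = 1) : Real.cos (errAngle p / 2) = p 0 := by
  have := abs_le.1 (abs_zero_le_one hp)
  rw [errAngle, mul_div_cancel_left₀ _ two_ne_zero, Real.cos_arccos this.1 this.2]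

theorem errAngle_le_iff {p : Quat} (hp : ‖p‖ = 1) {z : ℝ} (hz0 : 0 ≤ z) (hz1 : z ≤ 2 * Real.pi) :
    errAngle p ≤ z ↔ Real.cos (z / 2) ≤ p 0 := by
  rw [← cos_half_errAngle hp, Real.strictAntiOn_cos.le_iff_ge]
  · constructor <;> intro h <;> linarith
  · constructor <;> linarith
  · have := errAngle_nonneg p
    have := errAngle_le_two_pi p
    constructor <;> linarith

/-- Half the error angle lies in `[0, π]`, where `cos x ≤ 1 - 2x²/π²`. With `le_sq_errAngle`, this
makes `1 - q₀` comparable to the squared angle on the whole range. -/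
theorem sq_errAngle_le {p : Quat} (hp : ‖p‖ = 1) :
    errAngle p ^ 2 ≤ 2 * Real.pi ^ 2 * (1 - p 0) := by
  have h := Real.cos_le_one_sub_mul_cos_sq (x := errAngle p / 2) (by
    rw [abs_of_nonneg (by have := errAngle_nonneg p; positivity)]
    linarith [errAngle_le_two_pi p])
  rw [cos_half_errAngle hp] at h
  have hpi := Real.pi_pos
  have h2 : 2 * Real.pi ^ 2 * (2 / Real.pi ^ 2 * (errAngle p / 2) ^ 2) = errAngle p ^ 2 := by
    field_simp
  have h3 := mul_le_mul_of_nonneg_left h (by positivity : 0 ≤ 2 * Real.pi ^ 2)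
  linarith

theorem le_sq_errAngle {p : Quat} (hp : ‖p‖ = 1) : 1 - p 0 ≤ errAngle p ^ 2 / 8 := by
  have h := Real.one_sub_sq_div_two_le_cos (x := errAngle p / 2)
  rw [cos_half_errAngle hp] at h
  linarith

theorem ae_norm_le_supNorm {u : ℝ → E3} (hu : IsInput u) (T : ℝ) :
    ∀ᵐ t, t ∈ Icc 0 T → ‖u t‖ ≤ supNorm u T := by
  have h : MemLp u ⊤ (volume.restrict (Icc 0 T)) :=
    hu.mono_measure (Measure.restrict_mono Icc_subset_Ici_self le_rfl)
  rw [← ae_restrict_iff' measurableSet_Icc]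
  filter_upwards [ae_le_eLpNormEssSup (f := u) (μ := volume.restrict (Icc 0 T))] with t ht
  rw [supNorm, ← toReal_enorm]
  refine ENNReal.toReal_mono h.2.ne ?_
  rwa [eLpNorm_exponent_top]

theorem supNorm_nonneg (u : ℝ → E3) (T : ℝ) : 0 ≤ supNorm u T := ENNReal.toReal_nonneg

theorem cos_half_gt_neg_one {z : ℝ} (hz0 : 0 ≤ z) (hz1 : z < 2 * Real.pi) :
    0 < 1 + Real.cos (z / 2) := by
  have := Real.strictAntiOn_cos (a := z / 2) (b := Real.pi) ⟨by linarith, by linarith⟩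
    ⟨Real.pi_pos.le, le_rfl⟩ (by linarith)
  rw [Real.cos_pi] at this
  linarith

theorem isClassK_const_mul {C : ℝ} (hC : 0 < C) : IsClassK fun s => C * s :=
  ⟨by fun_prop, fun _ _ _ _ h => mul_lt_mul_of_pos_left h hC, mul_zero C⟩

/-- `V` lies between two multiples of `stateNorm ^ 2`, so its exponential estimate bounds the
squared state; `a² + b² ≤ (a + b)²` then separates transient and input. No fine tuning of the cross
term is needed: `η = 1`. -/
theorem isISSWithin {J : Matrix (Fin 3) (Fin 3) ℝ} (hJ : J.PosDef) {c zmax : ℝ} (hc : 0 < c)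
    (hz0 : 0 ≤ zmax) (hz1 : zmax < 2 * Real.pi) {k : ℝ} (hk : 0 < k) :
    IsISSWithin J (k ^ 2) (c * k) zmax := by
  obtain ⟨μ, N, α, G, hμ, hN, hα, hG, h⟩ :=
    exists_lyapunov hJ hc (cos_half_gt_neg_one hz0 hz1) one_pos le_rfl
  obtain ⟨V, hV, hd⟩ := h k hk
  have hpi := Real.pi_pos
  obtain ⟨κ, hκ, hκμ, hκk⟩ : ∃ κ : ℝ, 0 < κ ∧ κ ≤ μ ∧ κ ≤ k ^ 2 / (2 * Real.pi ^ 2) :=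
    ⟨min μ (k ^ 2 / (2 * Real.pi ^ 2)), by positivity, min_le_left _ _, min_le_right _ _⟩
  rw [le_div_iff₀ (by positivity)] at hκk
  have hlow : ∀ p x, ‖p‖ = 1 → κ * stateNorm p x ^ 2 ≤ V (p, x) := by
    intro p x hp
    rw [stateNorm, Real.sq_sqrt (by positivity)]
    have h1 := (hV p x hp).1
    have h2 : κ * ‖x‖ ^ 2 ≤ μ * ‖x‖ ^ 2 := by gcongr
    have h3 := mul_le_mul_of_nonneg_left (sq_errAngle_le hp) hκ.le
    have h4 : κ * (2 * Real.pi ^ 2) * (1 - p 0) ≤ k ^ 2 * (1 - p 0) := by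
      have := abs_le.1 (abs_zero_le_one hp)
      have : 0 ≤ 1 - p 0 := by linarith
      gcongr
    linarith
  have hup : ∀ p x, ‖p‖ = 1 → V (p, x) ≤ (N + k ^ 2) * stateNorm p x ^ 2 := by
    intro p x hp
    rw [stateNorm, Real.sq_sqrt (by positivity)]
    have h1 := (hV p x hp).2
    have h3 := mul_le_mul_of_nonneg_left (le_sq_errAngle hp) (sq_nonneg k)
    have h4 : 0 ≤ N * errAngle p ^ 2 := by positivity
    have h5 : 0 ≤ k ^ 2 * ‖x‖ ^ 2 := by positivity
    have h6 : 0 ≤ k ^ 2 * errAngle p ^ 2 := by positivity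
    linarith
  refine ⟨fun s t => √((N + k ^ 2) / κ) * Real.exp (-(k * α / 2) * t) * s,
    fun s => √(G / α / κ) * s, ⟨fun t _ => isClassK_const_mul (by positivity), fun s hs => ⟨?_, ?_⟩⟩,
    isClassK_const_mul (by positivity), ?_⟩
  · intro t _ t' _ htt'
    have : -(k * α / 2) * t' ≤ -(k * α / 2) * t :=
      mul_le_mul_of_nonpos_left htt' (by simpa using by positivity)
    dsimp only
    gcongr
  · have h1 : Tendsto (fun t => -(k * α / 2) * t) atTop atBot :=
      tendsto_id.const_mul_atTop_of_neg (by simpa using by positivity)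
    simpa using ((Real.tendsto_exp_atBot.comp h1).const_mul (√((N + k ^ 2) / κ))).mul_const s
  · intro u q w hu hsol T hT hz
    have hq : ∀ t ∈ Icc 0 T, 1 + Real.cos (zmax / 2) ≤ 1 + q t 0 := by
      intro t ht
      have := (errAngle_le_iff (hsol.norm_eq_one ht.1) hz0 hz1.le).1 (hz t ht)
      linarith
    have h1 := hd u q w hsol 0 T (supNorm u T) le_rfl hT (supNorm_nonneg u T) hq
      (ae_norm_le_supNorm hu T)
    have h2 := hlow (q T) (w T) (hsol.norm_eq_one hT)
    have h3 := hup (q 0) (w 0) hsol.unit_init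
    have h4 := mul_le_mul_of_nonneg_left h3 (Real.exp_pos (-(k * α) * (T - 0))).le
    set S := supNorm u T with hS
    have hS0 : 0 ≤ S := supNorm_nonneg u T
    set s := stateNorm (q 0) (w 0) with hs
    have hs0 : 0 ≤ s := Real.sqrt_nonneg _
    have hexp : Real.exp (-(k * α) * (T - 0)) = Real.exp (-(k * α / 2) * T) ^ 2 := by
      rw [← Real.exp_nat_mul]
      congr 1
      push_cast
      ring
    rw [hexp] at h1 h4
    refine abs_le_of_sq_le_sq' ?_ (by positivity) |>.2
    have h5 : stateNorm (q T) (w T) ^ 2 ≤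
        (√((N + k ^ 2) / κ) * Real.exp (-(k * α / 2) * T) * s) ^ 2 + (√(G / α / κ) * S) ^ 2 := by
      simp only [mul_pow]
      rw [Real.sq_sqrt (by positivity), Real.sq_sqrt (by positivity)]
      have h6 : κ * stateNorm (q T) (w T) ^ 2 ≤
          Real.exp (-(k * α / 2) * T) ^ 2 * ((N + k ^ 2) * s ^ 2) + G / α * S ^ 2 := by
        linarith
      calc stateNorm (q T) (w T) ^ 2 ≤
          (Real.exp (-(k * α / 2) * T) ^ 2 * ((N + k ^ 2) * s ^ 2) + G / α * S ^ 2) / κ := by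
            rw [le_div_iff₀ hκ]
            linarith
        _ = _ := by
            field_simp
    have h7 : 0 ≤ (√((N + k ^ 2) / κ) * Real.exp (-(k * α / 2) * T) * s) * (√(G / α / κ) * S) := by
      positivity
    nlinarith

/-! ### Asymptotic gain: upper bound -/

/-- A half-line is not null, so it meets every conull set. This makes `asympNorm` nonnegative, and
equal to the norm for constant inputs. -/
instance neBot_atTop_inf_ae : (atTop ⊓ ae (volume : Measure ℝ)).NeBot := by
  rw [inf_neBot_iff]
  intro s hs s' hs'
  obtain ⟨T, hT⟩ := mem_atTop_sets.1 hs
  have h : (Ici T ∩ s').Nonempty := by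
    by_contra hne
    rw [not_nonempty_iff_eq_empty, ← disjoint_iff_inter_eq_empty] at hne
    have h0 : volume (Ici T) = 0 := measure_mono_null hne.subset_compl_right hs'
    simp at h0
  exact h.mono fun t ht => ⟨hT t ht.1, ht.2⟩

theorem IsInput.exists_ae_norm_le {u : ℝ → E3} (hu : IsInput u) :
    ∃ C : ℝ, ∀ᵐ t, 0 ≤ t → ‖u t‖ ≤ C := by
  refine ⟨(eLpNorm u ⊤ (volume.restrict (Ici 0))).toReal, ?_⟩
  have h : ∀ᵐ t, t ∈ Ici (0 : ℝ) → ‖u t‖ ≤ (eLpNorm u ⊤ (volume.restrict (Ici 0))).toReal := by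
    rw [← ae_restrict_iff' measurableSet_Ici]
    filter_upwards [ae_le_eLpNormEssSup (f := u) (μ := volume.restrict (Ici 0))] with t ht
    rw [← toReal_enorm]
    refine ENNReal.toReal_mono hu.2.ne ?_
    rwa [eLpNorm_exponent_top]
  exact h

theorem asympNorm_nonneg (u : ℝ → E3) : 0 ≤ asympNorm u := by
  rw [asympNorm, limsup_eq]
  refine Real.sInf_nonneg fun a ha => ?_
  obtain ⟨t, ht⟩ := (show ∀ᶠ t in atTop ⊓ ae (volume : Measure ℝ), ‖u t‖ ≤ a from ha).exists
  exact (norm_nonneg _).trans ht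

theorem asympNorm_const (v : E3) : asympNorm (fun _ => v) = ‖v‖ := limsup_const _

/-- Essential boundedness is what gives the real-valued `limsup` its meaning; a set of the infimum
filter is then split into a half-line part and a conull part. -/
theorem IsInput.exists_ae_norm_le_of_asympNorm_lt {u : ℝ → E3} (hu : IsInput u) {a : ℝ}
    (ha : asympNorm u < a) : ∃ T : ℝ, 0 ≤ T ∧ ∀ᵐ t, T ≤ t → ‖u t‖ ≤ a := by
  obtain ⟨C, hC⟩ := hu.exists_ae_norm_le
  have hb : (atTop ⊓ ae (volume : Measure ℝ)).IsBoundedUnder (· ≤ ·) fun t => ‖u t‖ := by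
    refine ⟨C, ?_⟩
    rw [eventually_map]
    filter_upwards [(eventually_ge_atTop (0 : ℝ)).filter_mono inf_le_left,
      hC.filter_mono inf_le_right] with t ht h using h ht
  have h := eventually_lt_of_limsup_lt ha hb
  obtain ⟨s, hs, s', hs', hss⟩ := mem_inf_iff.1 h
  obtain ⟨T, hT⟩ := mem_atTop_sets.1 hs
  refine ⟨max T 0, le_max_right _ _, ?_⟩
  filter_upwards [hs'] with t ht hTt
  have hmem : t ∈ s ∩ s' := ⟨hT t ((le_max_left _ _).trans hTt), ht⟩
  rw [← hss] at hmem
  exact le_of_lt hmem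

/-- Restarting the Lyapunov estimate at a late time `T`, the transient vanishes and `k²(1 - q₀)` is
asymptotically at most `G / α * a ^ 2`, free of `k`. Dividing by `k²` and taking the root gives `C /
k`. -/
theorem exists_isAsymptoticGainWithin {J : Matrix (Fin 3) (Fin 3) ℝ} (hJ : J.PosDef) {c zmax : ℝ}
    (hc : 0 < c) (hz0 : 0 ≤ zmax) (hz1 : zmax < 2 * Real.pi) :
    ∃ C : ℝ, 0 < C ∧ ∀ k : ℝ, 0 < k →
      IsAsymptoticGainWithin J (k ^ 2) (c * k) zmax fun s => C / k * s := by
  obtain ⟨μ, N, α, G, hμ, hN, hα, hG, h⟩ :=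
    exists_lyapunov hJ hc (cos_half_gt_neg_one hz0 hz1) one_pos le_rfl
  have hpi := Real.pi_pos
  refine ⟨√(2 * Real.pi ^ 2 * (G / α)), by positivity, fun k hk =>
    ⟨isClassK_const_mul (by positivity), fun u q w hu hsol hz => ?_⟩⟩
  set C := √(2 * Real.pi ^ 2 * (G / α)) with hC
  have hCpos : 0 < C := by positivity
  have hC2 : C ^ 2 = 2 * Real.pi ^ 2 * (G / α) := Real.sq_sqrt (by positivity)
  obtain ⟨V, hV, hd⟩ := h k hk
  refine le_of_forall_gt_imp_ge_of_dense fun b hb => ?_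
  have ha0 := asympNorm_nonneg u
  -- Slack on both sides: the input is eventually below `a`, yet `C / k * a` is still below `b`.
  obtain ⟨a, ha, hab⟩ : ∃ a, asympNorm u < a ∧ C / k * a < b := by
    have : asympNorm u < b / (C / k) := by
      rw [lt_div_iff₀ (by positivity)]
      linarith
    obtain ⟨a, h1, h2⟩ := exists_between this
    rw [lt_div_iff₀ (by positivity)] at h2
    exact ⟨a, h1, by linarith⟩
  have hapos : 0 < a := ha0.trans_lt ha
  obtain ⟨T, hT, hTu⟩ := hu.exists_ae_norm_le_of_asympNorm_lt ha
  have hest : ∀ t, T ≤ t → errAngle (q t) ^ 2 ≤ 2 * Real.pi ^ 2 / k ^ 2 *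
      (Real.exp (-(k * α) * (t - T)) * V (q T, w T) + G / α * a ^ 2) := by
    intro t ht
    have hn := hsol.norm_eq_one (hT.trans ht)
    have h1 := hd u q w hsol T t a hT ht hapos.le (fun s hs => by
      have := (errAngle_le_iff (hsol.norm_eq_one (hT.trans hs.1)) hz0 hz1.le).1
        (hz s (hT.trans hs.1))
      linarith) (hTu.mono fun s hs hs' => hs hs'.1)
    have h2 := (hV (q t) (w t) hn).1
    have h3 : 0 ≤ μ * ‖w t‖ ^ 2 := by positivity
    refine (sq_errAngle_le hn).trans ?_
    calc 2 * Real.pi ^ 2 * (1 - q t 0) = 2 * Real.pi ^ 2 / k ^ 2 * (k ^ 2 * (1 - q t 0)) := by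
          field_simp
      _ ≤ _ := by
          gcongr
          linarith
  have hlim : Tendsto (fun t => 2 * Real.pi ^ 2 / k ^ 2 *
      (Real.exp (-(k * α) * (t - T)) * V (q T, w T) + G / α * a ^ 2)) atTop
      (𝓝 (2 * Real.pi ^ 2 / k ^ 2 * (0 * V (q T, w T) + G / α * a ^ 2))) := by
    have h1 : Tendsto (fun t => -(k * α) * (t - T)) atTop atBot :=
      (tendsto_atTop_add_const_right atTop (-T) tendsto_id).const_mul_atTop_of_neg
        (by simpa using by positivity)
    exact (((Real.tendsto_exp_atBot.comp h1).mul_const _).add_const _).const_mul _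
  have hbpos : 0 < b := lt_of_le_of_lt (by positivity) hab
  have hlt : 2 * Real.pi ^ 2 / k ^ 2 * (0 * V (q T, w T) + G / α * a ^ 2) < b ^ 2 := by
    calc _ = (C / k * a) ^ 2 := by
          rw [mul_pow, div_pow, hC2]
          ring
      _ < b ^ 2 := by gcongr
  refine limsup_le_of_le (isCoboundedUnder_le_of_le atTop fun t => errAngle_nonneg (q t)) ?_
  filter_upwards [hlim.eventually_lt_const hlt, eventually_ge_atTop T] with t h1 h2
  exact le_of_sq_le_sq ((hest t h2).trans h1.le) hbpos.le

/-! ### Invariance of the angle restriction -/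

/-- A potential barrier: for small `η`, the lower bound of `V` at angle `zmax` exceeds its upper
bound at angle `z₀`, `w = 0`. All terms are multiples of `k²`, so `r` does not depend on `k`. -/
theorem exists_restriction_radius {J : Matrix (Fin 3) (Fin 3) ℝ} (hJ : J.PosDef) {c zmax z₀ : ℝ}
    (hc : 0 < c) (hz0 : 0 ≤ z₀) (hz : z₀ < zmax) (hz1 : zmax < 2 * Real.pi) :
    ∃ r : ℝ, 0 < r ∧ ∀ k : ℝ, 0 < k → ∀ (u : ℝ → E3) (q : ℝ → Quat) (w : ℝ → E3),
      IsInput u → IsSolution J (k ^ 2) (c * k) u q w → errAngle (q 0) ≤ z₀ → ‖w 0‖ ≤ r * k →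
        (∀ T : ℝ, 0 ≤ T → supNorm u T ≤ r * k) → ∀ t : ℝ, 0 ≤ t → errAngle (q t) < zmax := by
  have hzm : 0 ≤ zmax := hz0.trans hz.le
  set e₀ := 1 - Real.cos (z₀ / 2) with he₀
  set e₁ := 1 - Real.cos (zmax / 2) with he₁
  have hcos : Real.cos (zmax / 2) < Real.cos (z₀ / 2) :=
    Real.strictAntiOn_cos ⟨by linarith, by linarith⟩ ⟨by linarith, by linarith⟩ (by linarith)
  have he0 : 0 ≤ e₀ := sub_nonneg.2 (Real.cos_le_one _)
  have he2 : e₁ ≤ 2 := by linarith [Real.neg_one_le_cos (zmax / 2)]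
  have he : e₀ < e₁ := by linarith
  -- As `e₀ + e₁ < 4`, this leaves `2(e₁ - e₀) - η(e₀ + e₁) > 0`.
  obtain ⟨η, hη, hη1, hηe⟩ : ∃ η : ℝ, 0 < η ∧ η ≤ 1 ∧ η ≤ (e₁ - e₀) / 4 :=
    ⟨min 1 ((e₁ - e₀) / 4), lt_min one_pos (by linarith), min_le_left _ _, min_le_right _ _⟩
  obtain ⟨μ, N, α, G, hμ, hN, hα, hG, h⟩ :=
    exists_lyapunov hJ hc (cos_half_gt_neg_one hzm hz1) hη hη1
  have hgap : 0 < (2 - η) * e₁ - (2 + η) * e₀ := by nlinarith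
  obtain ⟨r, hr, hrgap⟩ : ∃ r : ℝ, 0 < r ∧
      (N + G / α) * r ^ 2 < (2 - η) * e₁ - (2 + η) * e₀ := by
    set d := (2 - η) * e₁ - (2 + η) * e₀
    refine ⟨√(d / (2 * (N + G / α))), by positivity, ?_⟩
    rw [Real.sq_sqrt (by positivity)]
    have : (N + G / α) * (d / (2 * (N + G / α))) = d / 2 := by field_simp
    linarith
  refine ⟨r, hr, fun k hk u q w hu hsol hq0 hw0 hur t ht => ?_⟩
  obtain ⟨V, hV, hd⟩ := h k hk
  by_contra hcon
  have hcont : ContinuousOn (fun s => q s 0) (Icc 0 t) := by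
    have := (hsol.absCont_q t ht).continuousOn
    rw [uIcc_of_le ht] at this
    exact (EuclideanSpace.proj (𝕜 := ℝ) (0 : Fin 4)).continuous.comp_continuousOn this
  have hq0' := (errAngle_le_iff hsol.unit_init hz0 (by linarith)).1 hq0
  have hqt : q t 0 ≤ Real.cos (zmax / 2) := by
    rw [not_lt] at hcon
    rw [← cos_half_errAngle (hsol.norm_eq_one ht)]
    refine Real.strictAntiOn_cos.antitoneOn ⟨by linarith, by linarith⟩ ?_ (by linarith)
    have := errAngle_nonneg (q t)
    have := errAngle_le_two_pi (q t)
    constructor <;> linarith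
  -- The first time `s` of reaching `zmax`; the Lyapunov estimate is valid up to and including it.
  obtain ⟨s, hs, hqs, hbefore⟩ : ∃ s ∈ Icc 0 t, q s 0 ≤ Real.cos (zmax / 2) ∧
      ∀ x ∈ Icc 0 s, Real.cos (zmax / 2) ≤ q x 0 := by
    let S := Icc 0 t ∩ (fun s => q s 0) ⁻¹' Iic (Real.cos (zmax / 2))
    have hS : IsClosed S := hcont.preimage_isClosed_of_isClosed isClosed_Icc isClosed_Iic
    have hbdd : BddBelow S := ⟨0, fun x hx => hx.1.1⟩
    have hs : sInf S ∈ S := hS.csInf_mem ⟨t, ⟨ht, le_rfl⟩, hqt⟩ hbdd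
    refine ⟨sInf S, hs.1, hs.2, fun x hx => ?_⟩
    by_contra! hlt
    -- Aiming at the midpoint, rather than at the level itself, ensures that `y = x` is
    -- contradictory.
    obtain ⟨y, hy, hye⟩ := intermediate_value_Icc' hx.1
      (hcont.mono (Icc_subset_Icc_right (hx.2.trans hs.1.2)))
      (show (q x 0 + Real.cos (zmax / 2)) / 2 ∈ Icc (q x 0) (q 0 0) by constructor <;> linarith)
    have hyS : y ∈ S := ⟨⟨hy.1, (hy.2.trans hx.2).trans hs.1.2⟩, by
      have : q y 0 = (q x 0 + Real.cos (zmax / 2)) / 2 := hye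
      simp only [mem_preimage, mem_Iic]
      linarith⟩
    have h1 : sInf S ≤ y := csInf_le hbdd hyS
    have h2 : y = x := le_antisymm hy.2 (hx.2.trans h1)
    rw [h2] at hye
    simp only at hye
    linarith
  have h1 := hd u q w hsol 0 s (r * k) le_rfl hs.1 (by positivity)
    (fun x hx => by linarith [hbefore x hx])
    ((ae_norm_le_supNorm hu s).mono fun x hx hx' => (hx hx').trans (hur s hs.1))
  have h2 := (hV (q s) (w s) (hsol.norm_eq_one hs.1)).1
  have h3 := (hV (q 0) (w 0) hsol.unit_init).2
  have h4 : N * ‖w 0‖ ^ 2 + (2 + η) * (k ^ 2 * (1 - q 0 0)) ≤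
      N * (r * k) ^ 2 + (2 + η) * (k ^ 2 * e₀) := by
    gcongr
    linarith
  have h5 : (2 - η) * (k ^ 2 * e₁) ≤ μ * ‖w s‖ ^ 2 + (2 - η) * (k ^ 2 * (1 - q s 0)) := by
    have : (2 - η) * (k ^ 2 * e₁) ≤ (2 - η) * (k ^ 2 * (1 - q s 0)) := by
      have : 0 ≤ 2 - η := by linarith
      gcongr
      linarith
    have : 0 ≤ μ * ‖w s‖ ^ 2 := by positivity
    linarith
  have h6 : Real.exp (-(k * α) * (s - 0)) * V (q 0, w 0) ≤ V (q 0, w 0) := by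
    have hV0 : 0 ≤ V (q 0, w 0) := by
      refine le_trans ?_ (hV (q 0) (w 0) hsol.unit_init).1
      have := abs_le.1 (abs_zero_le_one hsol.unit_init)
      have h7 : 0 ≤ 1 - q 0 0 := by linarith
      have h8 : 0 ≤ 2 - η := by linarith
      positivity
    refine mul_le_of_le_one_left hV0 (Real.exp_le_one_iff.2 ?_)
    have : 0 ≤ k * α * s := mul_nonneg (by positivity) hs.1
    linarith
  have h7 := mul_lt_mul_of_pos_left hrgap (by positivity : 0 < k ^ 2)
  nlinarith

/-! ### Asymptotic gain: lower bound -/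

theorem exists_eigenvector {J : Matrix (Fin 3) (Fin 3) ℝ} (hJ : J.PosDef) :
    ∃ (e : E3) (ρ : ℝ), ‖e‖ = 1 ∧ inertia J e = ρ • e := by
  refine ⟨hJ.isHermitian.eigenvectorBasis 0, hJ.isHermitian.eigenvalues 0,
    hJ.isHermitian.eigenvectorBasis.orthonormal.1 0, ?_⟩
  exact WithLp.ofLp_injective 2 (hJ.isHermitian.mulVec_eigenvectorBasis 0)

/-- At a constant angular velocity along a principal axis, the loop has an equilibrium with
`q_v` parallel to that axis. -/
theorem isSolution_const {J : Matrix (Fin 3) (Fin 3) ℝ} {e : E3} {ρ : ℝ} (he : ‖e‖ = 1)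
    (hρ : inertia J e = ρ • e) {Kp Kd s p : ℝ} (hp : p ^ 2 ≤ 1) (hs : Kp * p = Kd * s) :
    IsSolution J Kp Kd (fun _ => s • e)
      (fun _ => !₂[√(1 - p ^ 2), p * e 0, p * e 1, p * e 2]) (fun _ => s • e) := by
  have him : imPart !₂[√(1 - p ^ 2), p * e 0, p * e 1, p * e 2] = p • e := by
    ext i
    fin_cases i <;> simp [imPart]
  refine ⟨?_, fun T _ => ?_, fun T _ => ?_, ae_of_all _ fun t => ?_, ae_of_all _ fun t => ?_⟩
  · rw [← pow_eq_one_iff_of_nonneg (norm_nonneg _) two_ne_zero, quat_norm_sq_eq, him, norm_smul,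
      he, mul_one, Real.norm_eq_abs, sq_abs]
    simp [Real.sq_sqrt (sub_nonneg.2 hp)]
  · exact ContDiffOn.absolutelyContinuousOnInterval (by fun_prop)
  · exact ContDiffOn.absolutelyContinuousOnInterval (by fun_prop)
  · refine (hasDerivAt_const t _).congr_deriv ?_
    ext i
    simp
  · refine ⟨0, hasDerivAt_const t _, ?_⟩
    have h : inertia J 0 = -cross (s • e) (inertia J (s • e)) +
        torque Kp Kd !₂[√(1 - p ^ 2), p * e 0, p * e 1, p * e 2] (s • e) := by
      -- On a principal axis `J w` is parallel to `w`, so the gyroscopic torque vanishes.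
      have h1 : cross (s • e) (inertia J (s • e)) = 0 := by
        have h2 : inertia J (s • e) = ρ • (s • e) := by rw [map_smul, hρ, smul_comm]
        rw [h2, cross, WithLp.ofLp_smul, Matrix.mulVec_smul, WithLp.toLp_smul]
        exact (congrArg (ρ • ·) (cross_self (s • e))).trans (smul_zero ρ)
      rw [map_zero, h1, torque, him, smul_smul, smul_smul, hs]
      simp
    exact congrArg WithLp.ofLp h

/-- The equilibrium with `p = cs/k` balances proportional and damping torque; its error angle is `2
arcsin p ≥ 2p`. -/
theorem exists_gain_lower_bound {J : Matrix (Fin 3) (Fin 3) ℝ} (hJ : J.PosDef) {c zmax : ℝ}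
    (hc : 0 < c) (hz0 : 0 < zmax) :
    ∃ δ : ℝ, 0 < δ ∧ ∀ k : ℝ, 0 < k → ∀ g : ℝ → ℝ,
      IsAsymptoticGainWithin J (k ^ 2) (c * k) zmax g →
        ∀ s : ℝ, 0 ≤ s → s ≤ δ * k → 2 * c / k * s ≤ g s := by
  obtain ⟨e, ρ, he, hρ⟩ := exists_eigenvector hJ
  have hpi := Real.pi_pos
  -- `θ ≤ zmax / 2` makes the equilibrium respect the restriction; `θ ≤ π / 2` gives `arcsin (sin θ)
  -- = θ`.
  obtain ⟨θ, hθ0, hθ1, hθ2⟩ : ∃ θ : ℝ, 0 < θ ∧ θ ≤ zmax / 2 ∧ θ ≤ Real.pi / 2 :=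
    ⟨min (zmax / 2) (Real.pi / 2), by positivity, min_le_left _ _, min_le_right _ _⟩
  have hsin : 0 < Real.sin θ := Real.sin_pos_of_pos_of_lt_pi hθ0 (by linarith)
  refine ⟨Real.sin θ / c, by positivity, fun k hk g hg s hs hsδ => ?_⟩
  set p := c / k * s with hp
  have hp0 : 0 ≤ p := by positivity
  have hpθ : p ≤ Real.sin θ := by
    calc p ≤ c / k * (Real.sin θ / c * k) := by
          rw [hp]
          gcongr
      _ = Real.sin θ := by field_simp
  have hp1 : p ≤ 1 := hpθ.trans (Real.sin_le_one _)
  have hsol := isSolution_const (Kp := k ^ 2) (Kd := c * k) (s := s) (p := p) he hρ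
    (by nlinarith) (by rw [hp]; field_simp)
  have hangle : errAngle !₂[√(1 - p ^ 2), p * e 0, p * e 1, p * e 2] = 2 * Real.arcsin p := by
    rw [errAngle, Real.arcsin_eq_arccos hp0]
    simp
  have harc : Real.arcsin p ≤ θ := by
    rw [← Real.arcsin_sin (by linarith) hθ2]
    exact Real.monotone_arcsin hpθ
  have h := hg.2 _ _ _ (memLp_top_const _) hsol (fun t _ => by rw [hangle]; linarith)
  rw [hangle, limsup_const, asympNorm_const, norm_smul, he, mul_one, Real.norm_eq_abs,
    abs_of_nonneg hs] at h
  refine le_trans ?_ h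
  have h1 : p ≤ Real.arcsin p := by
    rw [Real.le_arcsin_iff_sin_le ⟨by linarith, by linarith [Real.pi_gt_three]⟩
      ⟨by linarith, hp1⟩]
    exact Real.sin_le hp0
  calc 2 * c / k * s = 2 * p := by rw [hp]; ring
    _ ≤ _ := by linarith

/-! ### Forward completeness -/

/-- An admissible input has a bounded, everywhere measurable representative. -/
theorem IsInput.exists_representative {u : ℝ → E3} (hu : IsInput u) :
    ∃ (v : ℝ → E3) (C : ℝ), StronglyMeasurable v ∧ (∀ t, ‖v t‖ ≤ C) ∧
      ∀ᵐ t, 0 ≤ t → u t = v t := by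
  obtain ⟨C, hC⟩ := hu.exists_ae_norm_le
  obtain ⟨g, hg, hug⟩ := hu.1
  rw [EventuallyEq, ae_restrict_iff' measurableSet_Ici] at hug
  -- With `max C 0` in place of `C`, the value `0` off the set also obeys the bound.
  refine ⟨{t | ‖g t‖ ≤ max C 0}.indicator g, max C 0, hg.indicator
    (measurableSet_le hg.norm.measurable measurable_const), fun t => ?_, ?_⟩
  · by_cases h : t ∈ {t | ‖g t‖ ≤ max C 0}
    · rw [indicator_of_mem h]
      exact h
    · rw [indicator_of_notMem h, norm_zero]
      exact le_max_right _ _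
  · filter_upwards [hC, hug] with t h1 h2 ht
    have h3 : t ∈ {t | ‖g t‖ ≤ max C 0} := by
      have := h1 ht
      rw [h2 ht] at this
      exact this.trans (le_max_left _ _)
    rw [indicator_of_mem h3]
    exact h2 ht

/-- The right-hand side of the closed loop, solved for the derivatives. -/
noncomputable def field (J : Matrix (Fin 3) (Fin 3) ℝ) (Kp Kd : ℝ) (x : (Quat × E3) × E3) : Quat × E3 :=
  ((1 / 2 : ℝ) • kin x.1.1 (x.2 - x.1.2),
    inertia J⁻¹ (-cross x.1.2 (inertia J x.1.2) + (Kp • imPartL x.1.1 - Kd • x.1.2)))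

theorem contDiff_field (J : Matrix (Fin 3) (Fin 3) ℝ) (Kp Kd : ℝ) :
    ContDiff ℝ 1 (field J Kp Kd) := by
  have h1 : ContDiff ℝ 1 fun x : (Quat × E3) × E3 => kin x.1.1 (x.2 - x.1.2) :=
    contDiff_kin.comp (f := fun x : (Quat × E3) × E3 => (x.1.1, x.2 - x.1.2)) (by fun_prop)
  have h2 : ContDiff ℝ 1 fun x : (Quat × E3) × E3 => cross x.1.2 (inertia J x.1.2) :=
    contDiff_cross.comp (f := fun x : (Quat × E3) × E3 => (x.1.2, inertia J x.1.2)) (by fun_prop)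
  unfold field
  fun_prop

theorem inertia_inv_apply {J : Matrix (Fin 3) (Fin 3) ℝ} (hJ : J.PosDef) (x : E3) :
    inertia J (inertia J⁻¹ x) = x := by
  have h : J * J⁻¹ = 1 := Matrix.mul_nonsing_inv J ((Matrix.isUnit_iff_isUnit_det J).1 hJ.isUnit)
  refine WithLp.ofLp_injective 2 ?_
  change J *ᵥ (J⁻¹ *ᵥ x.ofLp) = x.ofLp
  rw [Matrix.mulVec_mulVec, h, Matrix.one_mulVec]

/-- The kinetic energy decreases at large angular velocities, also when the closed loop is slowed
down by a factor `r`. -/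
theorem exists_energy_deriv_nonpos {J : Matrix (Fin 3) (Fin 3) ℝ} (hJ : J.PosDef) {Kp Kd N : ℝ}
    (hKp : 0 < Kp) (hKd : 0 < Kd) (hN0 : 0 < N) (hN : ∀ x, ‖inertia J x‖ ≤ N * ‖x‖)
    {w : ℝ → E3} {p : Quat} {v : E3} {r t : ℝ} (hr : 0 ≤ r) (hp : ‖p‖ = 1)
    (hw : HasDerivAt w (r • (field J Kp Kd ((p, w t), v)).2) t)
    (hlt : N * (Kp / Kd) ^ 2 < ⟪w t, inertia J (w t)⟫) :
    ∃ d ≤ 0, HasDerivAt (fun t => ⟪w t, inertia J (w t)⟫) d t := by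
  have hE : inertia J (field J Kp Kd ((p, w t), v)).2 =
      -cross (w t) (inertia J (w t)) + (Kp • imPart p - Kd • w t) :=
    inertia_inv_apply hJ _
  have h := hw.inner ℝ ((inertia J).hasFDerivAt.comp_hasDerivAt t hw)
  refine ⟨_, ?_, h⟩
  have hpow : ⟪w t, inertia J (field J Kp Kd ((p, w t), v)).2⟫ =
      Kp * ⟪w t, imPart p⟫ - Kd * ‖w t‖ ^ 2 := by
    rw [hE]
    simp only [inner_smul_right, inner_add_right, inner_sub_right, inner_neg_right,
      inner_cross_self, real_inner_self_eq_norm_sq]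
    ring
  rw [Function.comp_apply, ← inertia_symm hJ _ (w t), real_inner_comm (w t), map_smul,
    inner_smul_right, hpow]
  have h1 : ⟪w t, imPart p⟫ ≤ ‖w t‖ * 1 :=
    (real_inner_le_norm _ _).trans (by gcongr; exact hp ▸ norm_imPart_le p)
  -- Above this speed the damping power `Kd‖w‖²` dominates the proportional power, at most `Kp‖w‖`.
  have h2 : Kp / Kd ≤ ‖w t‖ := by
    have h4 : N * (Kp / Kd) ^ 2 < N * ‖w t‖ ^ 2 := hlt.trans_le (inner_inertia_le hN _)
    exact le_of_sq_le_sq (lt_of_mul_lt_mul_left h4 hN0.le).le (norm_nonneg _)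
  rw [div_le_iff₀ hKd] at h2
  have h5 : Kp * ⟪w t, imPart p⟫ - Kd * ‖w t‖ ^ 2 ≤ 0 := by
    have h3 := mul_le_mul_of_nonneg_left h1 hKp.le
    have h4 := mul_le_mul_of_nonneg_right h2 (norm_nonneg (w t))
    linarith
  have h6 := mul_nonneg hr (neg_nonneg.2 h5)
  linarith

theorem absCont_energy (J : Matrix (Fin 3) (Fin 3) ℝ) {w : ℝ → E3} {a b : ℝ}
    (hw : AbsolutelyContinuousOnInterval w a b) :
    AbsolutelyContinuousOnInterval (fun t => ⟪w t, inertia J (w t)⟫) a b := by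
  have h : ContDiff ℝ 1 fun x : E3 => ⟪x, inertia J x⟫ :=
    ContDiff.inner ℝ (by fun_prop) (by fun_prop)
  exact AbsolutelyContinuousOnInterval.comp_contDiff (g := fun x => ⟪x, inertia J x⟫) hw h

theorem hasDerivAt_smul_prod {E F : Type*} [NormedAddCommGroup E] [NormedSpace ℝ E]
    [NormedAddCommGroup F] [NormedSpace ℝ F] {x : ℝ → E} {y : ℝ → F} {r t : ℝ} {p : E × F}
    (h : HasDerivAt (fun t => (x t, y t)) (r • p) t) :
    HasDerivAt x (r • p.1) t ∧ HasDerivAt y (r • p.2) t :=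
  ⟨(ContinuousLinearMap.fst ℝ E F).hasFDerivAt.comp_hasDerivAt t h,
    (ContinuousLinearMap.snd ℝ E F).hasFDerivAt.comp_hasDerivAt t h⟩

/-- For the closed loop slowed down by factors `χ t ≥ 0`, the angular velocity stays below a
bound that does not depend on `χ`. -/
theorem exists_velocity_bound {J : Matrix (Fin 3) (Fin 3) ℝ} (hJ : J.PosDef) {Kp Kd : ℝ}
    (hKp : 0 < Kp) (hKd : 0 < Kd) (w₀ : E3) :
    ∃ R : ℝ, ∀ (q : ℝ → Quat) (w v : ℝ → E3) (χ : ℝ → ℝ), w 0 = w₀ → ‖q 0‖ = 1 →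
      (∀ t, 0 ≤ χ t) → (∀ T, 0 ≤ T → AbsolutelyContinuousOnInterval q 0 T) →
      (∀ T, 0 ≤ T → AbsolutelyContinuousOnInterval w 0 T) →
      (∀ᵐ t, 0 ≤ t → HasDerivAt (fun t => (q t, w t))
        (χ t • field J Kp Kd ((q t, w t), v t)) t) →
      ∀ T, 0 ≤ T → ‖q T‖ = 1 ∧ ‖w T‖ ≤ R := by
  obtain ⟨μ, N, hμ, hμN, hlow, hup⟩ := exists_inertia_bounds hJ
  have hN : 0 < N := hμ.trans_le hμN
  refine ⟨√(max ⟪w₀, inertia J w₀⟫ (N * (Kp / Kd) ^ 2) / μ),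
    fun q w v χ hw0 hq0 hχ hqac hwac hd T hT => ?_⟩
  have hnorm : ∀ T, 0 ≤ T → ‖q T‖ = 1 := fun T hT =>
    norm_eq_one_of_ae_hasDerivAt (r := fun t => χ t * (1 / 2)) (v := fun t => v t - w t) hT hq0
      (hqac T hT) (by
        filter_upwards [hd] with t ht ht0
        have h := (hasDerivAt_smul_prod (ht ht0)).1
        rwa [field, smul_smul] at h)
  refine ⟨hnorm T hT, ?_⟩
  have hac := absCont_energy J (hwac T hT)
  have hle : ⟪w T, inertia J (w T)⟫ ≤ max ⟪w₀, inertia J w₀⟫ (N * (Kp / Kd) ^ 2) := by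
    have h0 : ⟪w 0, inertia J (w 0)⟫ ≤ max ⟪w₀, inertia J w₀⟫ (N * (Kp / Kd) ^ 2) := by
      rw [hw0]
      exact le_max_left _ _
    refine AbsolutelyContinuousOnInterval.le_of_ae_deriv_nonpos_above
      (φ := fun t => ⟪w t, inertia J (w t)⟫) hT hac h0 ?_
    filter_upwards [hd] with t ht hmem hlt
    exact exists_energy_deriv_nonpos hJ hKp hKd hN hup (hχ t) (hnorm t hmem.1.le)
      (hasDerivAt_smul_prod (ht hmem.1.le)).2
      ((le_max_right _ _).trans_lt hlt)
  refine Real.le_sqrt_of_sq_le ?_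
  rw [le_div_iff₀ hμ, mul_comm]
  exact (hlow (w T)).trans hle

/-- The a priori bound `R` holds for every cut-off, so the cut-off radius can be chosen after it
without circularity. The solution of the truncated system then never leaves the region where the
factor is `1`. -/
theorem isForwardComplete {J : Matrix (Fin 3) (Fin 3) ℝ} (hJ : J.PosDef) {Kp Kd : ℝ}
    (hKp : 0 < Kp) (hKd : 0 < Kd) : IsForwardComplete J Kp Kd := by
  intro q₀ w₀ u hq₀ hu
  obtain ⟨v, C, hv, hvC, huv⟩ := hu.exists_representative
  obtain ⟨R, hR⟩ := exists_velocity_bound hJ hKp hKd w₀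
  have hr : 0 < max (max 1 R) C := lt_max_of_lt_left (lt_max_of_lt_left one_pos)
  -- The bump acts on state and input jointly, so that `H` has compact support; its inner radius
  -- covers `‖q‖ = 1`, `‖w‖ ≤ R` and `‖v‖ ≤ C`.
  let χ : ContDiffBump (0 : (Quat × E3) × E3) := ⟨max (max 1 R) C, max (max 1 R) C + 1, hr, by simp⟩
  let H : (Quat × E3) × E3 → Quat × E3 := fun x => χ x • field J Kp Kd x
  have hHd : ContDiff ℝ 1 H := χ.contDiff.smul (contDiff_field J Kp Kd)
  have hHs : HasCompactSupport H := χ.hasCompactSupport.smul_right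
  obtain ⟨K, hK⟩ := hHd.lipschitzWith_of_hasCompactSupport hHs one_ne_zero
  obtain ⟨M, hM⟩ := hHd.continuous.bounded_above_of_compact_support hHs
  obtain ⟨x, hx0, hxL, hxd⟩ := Caratheodory.exists_solution hK hM hv (q₀, w₀)
  have hqac : ∀ T, 0 ≤ T → AbsolutelyContinuousOnInterval (fun t => (x t).1) 0 T := fun T _ =>
    (LipschitzWith.prod_fst.comp hxL).lipschitzOnWith.absolutelyContinuousOnInterval
  have hwac : ∀ T, 0 ≤ T → AbsolutelyContinuousOnInterval (fun t => (x t).2) 0 T := fun T _ =>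
    (LipschitzWith.prod_snd.comp hxL).lipschitzOnWith.absolutelyContinuousOnInterval
  have hq0 : ‖(x 0).1‖ = 1 := by rw [hx0, hq₀]
  have hbound := hR (fun t => (x t).1) (fun t => (x t).2) v (fun t => χ (x t, v t))
    (by simp [hx0]) hq0 (fun t => χ.nonneg) hqac hwac hxd
  have hsol : ∀ᵐ t, 0 ≤ t → HasDerivAt x (field J Kp Kd (x t, u t)) t := by
    filter_upwards [hxd, huv] with t ht hut ht0
    have h1 : χ (x t, v t) = 1 := by
      refine χ.one_of_mem_closedBall ?_
      obtain ⟨h2, h3⟩ := hbound t ht0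
      rw [mem_closedBall_zero_iff, Prod.norm_def, Prod.norm_def]
      refine max_le (max_le ?_ ?_) ((hvC t).trans (le_max_right _ _))
      · exact h2.le.trans ((le_max_left _ _).trans (le_max_left _ _))
      · exact h3.trans ((le_max_right _ _).trans (le_max_left _ _))
    have h4 := ht ht0
    simp only [H, h1, one_smul] at h4
    rwa [hut ht0]
  refine ⟨fun t => (x t).1, fun t => (x t).2, ⟨hq0, hqac, hwac, ?_, ?_⟩, by simp [hx0],
    by simp [hx0]⟩
  · rw [ae_restrict_iff' measurableSet_Ici]
    filter_upwards [hsol] with t ht ht0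
    exact (ht ht0).fst
  · rw [ae_restrict_iff' measurableSet_Ici]
    filter_upwards [hsol] with t ht ht0
    refine ⟨_, (ht ht0).snd, ?_⟩
    exact congrArg WithLp.ofLp (inertia_inv_apply hJ _)

end AttitudeLoop

theorem proposition1 (J : Matrix (Fin 3) (Fin 3) ℝ) (hJ : J.PosDef) (c : ℝ) (hc : 0 < c)
    (zmax : ℝ) (hz0 : 0 < zmax) (hz1 : zmax < 2 * Real.pi) :
    -- with `K_d = c √K_p` the loop is forward complete and ISS, for all `K_p > 0`
    (∀ Kp : ℝ, 0 < Kp →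
      AttitudeLoop.IsForwardComplete J Kp (c * √Kp) ∧
      AttitudeLoop.IsISSWithin J Kp (c * √Kp) zmax) ∧
    -- the asymptotic gain can be made arbitrarily small by choosing `K_p` large
    (∀ ε : ℝ, 0 < ε → ∃ K₀ : ℝ, 0 < K₀ ∧ ∀ Kp : ℝ, K₀ ≤ Kp →
      AttitudeLoop.IsAsymptoticGainWithin J Kp (c * √Kp) zmax (fun s => ε * s)) ∧
    -- it scales like `1 / √K_p`: upper and lower bounds
    (∃ C : ℝ, 0 < C ∧ ∀ Kp : ℝ, 0 < Kp →
      AttitudeLoop.IsAsymptoticGainWithin J Kp (c * √Kp) zmax (fun s => C / √Kp * s)) ∧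
    (∃ δ : ℝ, 0 < δ ∧ ∀ Kp : ℝ, 0 < Kp → ∀ g : ℝ → ℝ,
      AttitudeLoop.IsAsymptoticGainWithin J Kp (c * √Kp) zmax g →
        ∀ s : ℝ, 0 ≤ s → s ≤ δ * √Kp → 2 * c / √Kp * s ≤ g s) ∧
    -- the restriction holds at all times on explicit sets of initial states and inputs, which
    -- grow with `K_p`
    (∀ z₀ : ℝ, z₀ < zmax → ∃ r : ℝ, 0 < r ∧ ∀ Kp : ℝ, 0 < Kp →
      ∀ (u : ℝ → AttitudeLoop.E3) (q : ℝ → AttitudeLoop.Quat) (w : ℝ → AttitudeLoop.E3),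
        AttitudeLoop.IsInput u → AttitudeLoop.IsSolution J Kp (c * √Kp) u q w →
        AttitudeLoop.errAngle (q 0) ≤ z₀ → ‖w 0‖ ≤ r * √Kp →
        (∀ T : ℝ, 0 ≤ T → AttitudeLoop.supNorm u T ≤ r * √Kp) →
          ∀ t : ℝ, 0 ≤ t → AttitudeLoop.errAngle (q t) < zmax) := by
  have hsq : ∀ Kp : ℝ, 0 < Kp → √Kp ^ 2 = Kp := fun Kp h => Real.sq_sqrt h.le
  obtain ⟨C, hC, hgain⟩ := AttitudeLoop.exists_isAsymptoticGainWithin hJ hc hz0.le hz1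
  have hgain' : ∀ Kp : ℝ, 0 < Kp →
      AttitudeLoop.IsAsymptoticGainWithin J Kp (c * √Kp) zmax (fun s => C / √Kp * s) := by
    intro Kp hKp
    have h := hgain (√Kp) (Real.sqrt_pos.2 hKp)
    rwa [hsq Kp hKp] at h
  refine ⟨fun Kp hKp => ⟨?_, ?_⟩, fun ε hε => ?_, ⟨C, hC, hgain'⟩, ?_, fun z₀ hz => ?_⟩
  · exact AttitudeLoop.isForwardComplete hJ hKp (by positivity)
  · have h := AttitudeLoop.isISSWithin hJ hc hz0.le hz1 (Real.sqrt_pos.2 hKp)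
    rwa [hsq Kp hKp] at h
  -- This threshold is equivalent to `C / √Kp ≤ ε`.
  · refine ⟨(C / ε) ^ 2, by positivity, fun Kp hKp => ?_⟩
    have hKp0 : 0 < Kp := lt_of_lt_of_le (by positivity) hKp
    refine ⟨AttitudeLoop.isClassK_const_mul hε, fun u q w hu hsol hzt =>
      ((hgain' Kp hKp0).2 u q w hu hsol hzt).trans ?_⟩
    have h1 : C / ε ≤ √Kp := Real.le_sqrt_of_sq_le hKp
    have h2 : C / √Kp ≤ ε := by
      rw [div_le_iff₀ hε] at h1
      rw [div_le_iff₀ (Real.sqrt_pos.2 hKp0)]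
      linarith
    exact mul_le_mul_of_nonneg_right h2 (AttitudeLoop.asympNorm_nonneg u)
  · obtain ⟨δ, hδ, h⟩ := AttitudeLoop.exists_gain_lower_bound hJ hc hz0
    refine ⟨δ, hδ, fun Kp hKp g hg => h (√Kp) (Real.sqrt_pos.2 hKp) g ?_⟩
    rwa [hsq Kp hKp]
  -- `max z₀ 0` also admits negative `z₀`, which the radius lemma excludes.
  · obtain ⟨r, hr, h⟩ := AttitudeLoop.exists_restriction_radius hJ hc (le_max_right z₀ 0)
      (max_lt hz hz0) hz1
    refine ⟨r, hr, fun Kp hKp u q w hu hsol hq => h (√Kp) (Real.sqrt_pos.2 hKp) u q w hu ?_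
      (hq.trans (le_max_left _ _))⟩
    rwa [hsq Kp hKp]
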